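/- Let $G=(V,E)$ be a finite connected simple graph with $|E|\ge 2$, and put $k=|V|$. Consider the following game. The starting state is a vector $\mathbf n=(n_e)_{e\in E}$ of non-negative integers, and $n=\sum_{e\in E}n_e$. In each of $n$ rounds a vertex is drawn uniformly at random from $V$, independently of the other rounds; the player, who knows the vertices drawn so far, selects an edge incident with the drawn vertex, and the value of that edge is decreased by $1$. The player wins if after $n$ rounds all values are $0$. Let $p_G(\mathbf n)$ be the winning probability under an optimal strategy, that is, the supremum of the winning probability over all strategies. Let $\mathcal S_G$ be the set of all $\mathbf x\in\mathbb R^E$ with $x_e\ge 0$ for all $e$ and $\sum_{e\in E}x_e=1$. For $F\subseteq E$ let $d(F)$ be the number of vertices $v\in V$ such that all edges of $G$ incident with $v$ belong to $F$. Put $$\mathcal R_G=\Big\{\mathbf x\in\mathcal S_G:\ \sum_{e\in F}x_e>\frac{d(F)}{k}\ \text{ for all } \emptyset\subsetneq F\subsetneq E\Big\},$$ $$\mathcal I_G=\Big\{\mathbf x\in\mathcal S_G:\ \sum_{e\in F}x_e<\frac{d(F)}{k}\ \text{ for some } \emptyset\subsetneq F\subsetneq E\Big\}.$$ (i) For every $\mathbf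 x\in\mathcal I_G$ there is a rate $\lambda>0$ such that for every $C$ there is a constant $A$ with $$p_G(\mathbf n)\le A\,e^{-\lambda n}$$ for all starting states $\mathbf n$ with $|n_e-n x_e|\le C$ for all $e\in E$. Moreover, the rate is bounded away from $0$ on sets bounded away from $\mathcal R_G$: for every $\delta>0$ there is $\lambda>0$ such that for every $C$ there is a constant $A$ such that this bound holds for all $\mathbf x\in\mathcal I_G$ at Euclidean distance at least $\delta$ from $\mathcal R_G$ and all starting states $\mathbf n$ with $|n_e-n x_e|\le C$ for all $e\in E$. (ii) There is a constant $c_G>0$, depending only on $G$, such that for every $\mathbf x\in\mathcal R_G$ and every $C$, $p_G(\mathbf n)\to c_G$ as $n\to\infty$, where $\mathbf n$ ranges over the starting states with $|n_e-n x_e|\le C$ for all $e\in E$. -/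

import Mathlib

namespace SeqAssign

variable {V : Type*} [Fintype V] [DecidableEq V] (G : SimpleGraph V) [DecidableRel G.Adj]

/-- A (deterministic, history dependent) strategy. When the vertex `v` is drawn and the vertices
drawn before it are listed in `h` (most recent first), the player uses the edge `choose h v`,
which has to be incident with `v`. -/
structure Strategy where
  choose : List V → V → G.edgeSet
  incident : ∀ (h : List V) (v : V), v ∈ (choose h v : Sym2 V)

variable {G}

/-- The state of the game under the strategy `σ`, from the starting state `N₀`, after the vertices
of the list have been drawn (most recent first): each draw decreases the value of the selected
edge by one. Values may become negative. -/
def Strategy.state (σ : Strategy G) (N₀ : G.edgeSet → ℕ) : List V → G.edgeSet → ℤ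
  | [] => fun e => (N₀ e : ℤ)
  | v :: h => σ.state N₀ h - Pi.single (σ.choose h v) 1

/-- The total `n = ∑ₑ nₑ` of a starting state, which is the number of rounds of the game. -/
def total (N₀ : G.edgeSet → ℕ) : ℕ := ∑ e, N₀ e

/-- The probability that `σ` wins from `N₀`, that is, that the state after all `n` rounds is
identically zero. The drawn vertices are i.i.d. uniform on `V`, so the law of the sequence
`ω` of draws is uniform on `Fin n → V`. -/
noncomputable def Strategy.winProb (σ : Strategy G) (N₀ : G.edgeSet → ℕ) : ℝ :=
  ((Finset.univ.filter fun ω : Fin (total N₀) → V =>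
      σ.state N₀ (List.ofFn ω).reverse = 0).card : ℝ) /
    (Fintype.card V : ℝ) ^ total N₀

variable (G)

/-- The optimal winning probability `p_G(N₀)`. -/
noncomputable def optWinProb (N₀ : G.edgeSet → ℕ) : ℝ :=
  ⨆ σ : Strategy G, σ.winProb N₀

/-- `deg_F(v)`: the number of edges in `F` incident with `v`. -/
def degIn (F : Finset G.edgeSet) (v : V) : ℕ :=
  (F.filter fun e : G.edgeSet => v ∈ (e : Sym2 V)).card

/-- `d(F)`: the number of vertices all of whose edges belong to `F`,
that is, with `deg_F(v) = deg_G(v)`. -/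
def fullDegCount (F : Finset G.edgeSet) : ℕ :=
  (Finset.univ.filter fun v : V => degIn G F v = G.degree v).card

/-- The region `R_G` in the probability simplex of `ℝ^E`. -/
def reachable : Set (EuclideanSpace ℝ G.edgeSet) :=
  {x | ((∀ e, 0 ≤ x e) ∧ ∑ e, x e = 1) ∧
    ∀ F : Finset G.edgeSet, F.Nonempty → F ≠ Finset.univ →
      (fullDegCount G F : ℝ) / Fintype.card V < ∑ e ∈ F, x e}

/-- The region `I_G` in the probability simplex of `ℝ^E`. -/
def inaccessible : Set (EuclideanSpace ℝ G.edgeSet) :=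
  {x | ((∀ e, 0 ≤ x e) ∧ ∑ e, x e = 1) ∧
    ∃ F : Finset G.edgeSet, F.Nonempty ∧ F ≠ Finset.univ ∧
      ∑ e ∈ F, x e < (fullDegCount G F : ℝ) / Fintype.card V}

/-- `N₀ = n x + O(1)` with the explicit bound `C` on each coordinate, where `n = ∑ₑ N₀ₑ`. -/
def Near (C : ℝ) (x : EuclideanSpace ℝ G.edgeSet) (N₀ : G.edgeSet → ℕ) : Prop :=
  ∀ e, |(N₀ e : ℝ) - (total N₀ : ℝ) * x e| ≤ C

end SeqAssign

set_option linter.unusedSectionVars false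

namespace SeqAssign

open Filter Topology

/-! Everything is reduced to the Bellman values of an abstract system of draws and choices
(`optWinProb_eq_value`).

Decay: a draw from `full F` must be answered in `F`, so the total on `F` falls at least as fast as a
binomial count. Where the initial total is too small by a linear amount, a Chernoff bound gives an
exponential rate that depends only on the violation (`value_le_exp`).

Limit: the best value over all states is nonincreasing in the number of rounds, and its limit
`limitValue` bounds all values from above asymptotically. For the lower bound, fix a horizon `t` and
a state around which a whole ball of states has nearly optimal value. From a distant state whose
displacement has margin, greedy play follows the straight line to that state and hits the ball with
high probability (`exists_steering_radius`), the height being an exponential Lyapunov function.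

The main difficulty is that such balls exist (`eventually_exists_ball`): moving a unit from `f` to
`e` must not spoil a nearly optimal state. Take a maximal set `Z` on which nearly optimal states can
stay bounded; maximality makes any state bounded at a further place worse by a fixed `γ`. A second
player with one unit too few at `f` copies optimal play and can, by a single deviation, pass the
deficit on to an alternative `f'`; it is harmless once it reaches `e`. If it could not leave a set
`H`, the number of forced draws would have to lie in a bounded window, which is unlikely by binomial
anti-concentration. Hence every asymptotic bound on `gain` can be contracted towards `A *
limitValue` (`HasGap.gain_step`, `of_contraction`). -/

/-- Every draw of a point of `V` lets the player choose an element of a nonempty finite set. -/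
structure ChoiceSystem (V E : Type*) where
  inc : V → Finset E
  nonempty : ∀ v, (inc v).Nonempty

/-! ### Bellman values -/

namespace ChoiceSystem

variable {V E : Type*} [Fintype V] [Fintype E] [DecidableEq V] [DecidableEq E]
  (S : ChoiceSystem V E)

/-- The optimal winning probability from the state `N` with `t` rounds to go. -/
noncomputable def value : ℕ → (E → ℤ) → ℝ
  | 0, N => if N = 0 then 1 else 0
  | t + 1, N => (∑ v, (S.inc v).sup' (S.nonempty v) fun e => value t (N - Pi.single e 1)) /
      Fintype.card V

theorem exists_best (t : ℕ) (N : E → ℤ) (v : V) : ∃ e ∈ S.inc v,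
    ((S.inc v).sup' (S.nonempty v) fun e => S.value t (N - Pi.single e 1)) =
      S.value t (N - Pi.single e 1) :=
  Finset.exists_mem_eq_sup' _ _

/-- An optimal choice at the draw `v` if `t` rounds remain afterwards. -/
noncomputable def best (t : ℕ) (N : E → ℤ) (v : V) : E := (S.exists_best t N v).choose

theorem best_mem (t : ℕ) (N : E → ℤ) (v : V) : S.best t N v ∈ S.inc v :=
  (S.exists_best t N v).choose_spec.1

theorem value_succ (t : ℕ) (N : E → ℤ) : S.value (t + 1) N =
    (∑ v, S.value t (N - Pi.single (S.best t N v) 1)) / Fintype.card V := by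
  rw [value]
  congr 1
  exact Finset.sum_congr rfl fun v _ => (S.exists_best t N v).choose_spec.2

theorem value_le_best (t : ℕ) (N : E → ℤ) {v : V} {e : E} (he : e ∈ S.inc v) :
    S.value t (N - Pi.single e 1) ≤ S.value t (N - Pi.single (S.best t N v) 1) := by
  have h := (S.exists_best t N v).choose_spec.2
  rw [best, ← h]
  exact Finset.le_sup' (fun e => S.value t (N - Pi.single e 1)) he

/-- All lower bounds on values enter here: greedy choices, the copying player and arbitrary
strategies of the game are compared with the optimum one round at a time. -/
theorem average_le_value_succ (t : ℕ) (N : E → ℤ) (c : V → E) (hc : ∀ v, c v ∈ S.inc v) :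
    (∑ v, S.value t (N - Pi.single (c v) 1)) / Fintype.card V ≤ S.value (t + 1) N := by
  rw [value_succ]
  gcongr with v
  exact S.value_le_best t N (hc v)

theorem value_nonneg (t : ℕ) (N : E → ℤ) : 0 ≤ S.value t N := by
  induction t generalizing N with
  | zero => rw [value]; split_ifs <;> norm_num
  | succ t ih =>
    rw [value_succ]
    exact div_nonneg (Finset.sum_nonneg fun v _ => ih _) (Nat.cast_nonneg _)

theorem average_le_of_le [Nonempty V] {f : V → ℝ} {c : ℝ} (h : ∀ v, f v ≤ c) :
    (∑ v, f v) / Fintype.card V ≤ c := by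
  have hk : (0 : ℝ) < Fintype.card V := by exact_mod_cast Fintype.card_pos
  rw [div_le_iff₀ hk]
  calc ∑ v, f v ≤ ∑ _v : V, c := Finset.sum_le_sum fun v _ => h v
    _ = c * Fintype.card V := by simp [mul_comm]

theorem value_le_one [Nonempty V] (t : ℕ) (N : E → ℤ) : S.value t N ≤ 1 := by
  induction t generalizing N with
  | zero => rw [value]; split_ifs <;> norm_num
  | succ t ih =>
    rw [value_succ]
    exact average_le_of_le fun v => ih _

/-- Coordinates never increase and each round removes exactly one unit, so a state violating either
condition cannot end at zero. -/
theorem nonneg_and_sum_of_value_ne_zero (t : ℕ) (N : E → ℤ) (h : S.value t N ≠ 0) :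
    (∀ e, 0 ≤ N e) ∧ ∑ e, N e = t := by
  induction t generalizing N with
  | zero =>
    rw [value] at h
    split_ifs at h with h0
    · subst h0; simp
    · exact absurd rfl h
  | succ t ih =>
    rw [value_succ] at h
    have h1 : ∑ v, S.value t (N - Pi.single (S.best t N v) 1) ≠ 0 := fun h0 => h (by simp [h0])
    obtain ⟨v, -, hv⟩ := Finset.exists_ne_zero_of_sum_ne_zero h1
    obtain ⟨h2, h3⟩ := ih _ hv
    constructor
    · intro e
      have := h2 e
      by_cases he : e = S.best t N v
      · subst he; simp at this; omega
      · simpa [Pi.single_eq_of_ne he] using this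
    · have : ∑ e, (N - Pi.single (S.best t N v) 1 : E → ℤ) e = ∑ e, N e - 1 := by
        simp [Finset.sum_sub_distrib]
      push_cast
      linarith

/-- A bound for the values of all states that are at most `r` on `Z` persists when more rounds
remain. -/
theorem value_le_of_le [Nonempty V] (Z : Finset E) (r : ℤ) {t t' : ℕ} (htt : t ≤ t') {c : ℝ}
    (h : ∀ N : E → ℤ, (∀ z ∈ Z, N z ≤ r) → S.value t N ≤ c) (N : E → ℤ)
    (hN : ∀ z ∈ Z, N z ≤ r) : S.value t' N ≤ c := by
  induction t', htt using Nat.le_induction generalizing N with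
  | base => exact h N hN
  | succ t' _ ih =>
    rw [value_succ]
    refine average_le_of_le fun v => ih _ fun z hz => ?_
    have h1 : (0 : ℤ) ≤ (Pi.single (S.best t' N v) 1 : E → ℤ) z := by
      by_cases hzz : z = S.best t' N v
      · subst hzz; simp
      · simp [Pi.single_eq_of_ne hzz]
    have h2 := hN z hz
    simp only [Pi.sub_apply]
    omega

/-- From a nonnegative state every win has at least the probability of one sequence of draws. -/
theorem pow_le_value [Nonempty V] (hcov : ∀ e, ∃ v, e ∈ S.inc v) (t : ℕ) (N : E → ℤ)
    (h0 : ∀ e, 0 ≤ N e) (hs : ∑ e, N e = t) : ((1 : ℝ) / Fintype.card V) ^ t ≤ S.value t N := by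
  have hk : (0 : ℝ) < Fintype.card V := by exact_mod_cast Fintype.card_pos
  induction t generalizing N with
  | zero =>
    have : N = 0 := by
      funext e
      have h1 := (Finset.sum_eq_zero_iff_of_nonneg fun e _ => h0 e).1 (by simpa using hs)
      exact h1 e (Finset.mem_univ e)
    simp [value, this]
  | succ t ih =>
    have h1 : ∃ e, 0 < N e := by
      by_contra! h
      have : ∑ e, N e ≤ 0 := Finset.sum_nonpos fun e _ => h e
      push_cast at hs
      omega
    obtain ⟨e, he⟩ := h1
    obtain ⟨v, hv⟩ := hcov e
    have h2 : ((1 : ℝ) / Fintype.card V) ^ t ≤ S.value t (N - Pi.single e 1) := by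
      refine ih _ (fun f => ?_) ?_
      · by_cases hf : f = e
        · subst hf; simp; omega
        · simpa [Pi.single_eq_of_ne hf] using h0 f
      · have : ∑ f, (N - Pi.single e 1 : E → ℤ) f = ∑ e, N e - 1 := by
          simp [Finset.sum_sub_distrib]
        rw [this, hs]; push_cast; ring
    rw [value_succ, pow_succ, mul_one_div]
    gcongr
    refine h2.trans ((S.value_le_best t N hv).trans ?_)
    exact Finset.single_le_sum (f := fun v => S.value t (N - Pi.single (S.best t N v) 1))
      (fun v _ => S.value_nonneg _ _) (Finset.mem_univ v)

/-! ### Blocks of optimal play and the copying player -/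

/-- How often each element occurs among the choices of a list of draws with choices. -/
def used (l : List (V × E)) : E → ℤ := fun e => ((l.map Prod.snd).count e : ℤ)

@[simp] theorem used_nil : used ([] : List (V × E)) = 0 := by
  funext e; simp [used]

theorem used_cons (q : V × E) (l : List (V × E)) :
    used (q :: l) = Pi.single q.2 1 + used l := by
  funext e
  by_cases h : e = q.2
  · subst h; simp [used]; ring
  · simp [used, h, Ne.symm h]

theorem used_nonneg (l : List (V × E)) (e : E) : 0 ≤ used l e := by simp [used]

/-- The expectation of `F` over the draws and choices, in chronological order, of `L` rounds of
optimal play after which `s` rounds remain. -/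
noncomputable def run (s : ℕ) : ℕ → (List (V × E) → ℝ) → (E → ℤ) → ℝ
  | 0, F, _ => F []
  | L + 1, F, N => (∑ v, run s L (fun l => F ((v, S.best (s + L) N v) :: l))
      (N - Pi.single (S.best (s + L) N v) 1)) / Fintype.card V

theorem run_mono (s L : ℕ) (N : E → ℤ) {F F' : List (V × E) → ℝ}
    (h : ∀ l : List (V × E), (∀ q ∈ l, q.2 ∈ S.inc q.1) → F l ≤ F' l) :
    S.run s L F N ≤ S.run s L F' N := by
  induction L generalizing N F F' with
  | zero => exact h [] (by simp)
  | succ L ih =>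
    simp only [run]
    gcongr with v
    refine ih _ fun l hl => h _ ?_
    simpa [S.best_mem] using fun a b hab => hl (a, b) hab

theorem run_add (s L : ℕ) (N : E → ℤ) (F F' : List (V × E) → ℝ) :
    S.run s L (fun l => F l + F' l) N = S.run s L F N + S.run s L F' N := by
  induction L generalizing N F F' with
  | zero => rfl
  | succ L ih => simp only [run, ih, Finset.sum_add_distrib, add_div]

theorem run_mul (s L : ℕ) (N : E → ℤ) (a : ℝ) (F : List (V × E) → ℝ) :
    S.run s L (fun l => a * F l) N = a * S.run s L F N := by
  induction L generalizing N F with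
  | zero => rfl
  | succ L ih => simp only [run, ih, ← Finset.mul_sum, mul_div_assoc]

theorem run_const [Nonempty V] (s L : ℕ) (N : E → ℤ) (a : ℝ) :
    S.run s L (fun _ => a) N = a := by
  induction L generalizing N with
  | zero => rfl
  | succ L ih => simp [run, ih]

theorem run_sum {ι : Type*} (T : Finset ι) (s L : ℕ) (N : E → ℤ) (F : ι → List (V × E) → ℝ) :
    S.run s L (fun l => ∑ i ∈ T, F i l) N = ∑ i ∈ T, S.run s L (F i) N := by
  classical
  induction T using Finset.induction_on with
  | empty => simpa using S.run_mul s L N 0 (fun _ => 0)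
  | insert i T hi ih => simp only [Finset.sum_insert hi, run_add, ih]

/-- Under optimal play the value is a martingale. -/
theorem value_add_eq_run (s L : ℕ) (N : E → ℤ) :
    S.value (s + L) N = S.run s L (fun l => S.value s (N - used l)) N := by
  induction L generalizing N with
  | zero => simp [run]
  | succ L ih =>
    rw [← Nat.add_assoc, value_succ]
    simp only [run, ih, used_cons, sub_sub]

/-- A second player starts with one unit more on `e` and one unit less on `f`, copies the optimal
choices, and once answers a choice of `f` at the draw `w` by `f'`: this shifts the missing unit
from `f` to `f'`. -/
theorem run_shift_le_value (s L : ℕ) (N : E → ℤ) (e f : E) (w : V) (f' : E) :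
    S.run s L (fun l => S.value s (N - used l + Pi.single e 1 -
        Pi.single (if f' ∈ S.inc w ∧ (w, f) ∈ l then f' else f) 1)) N ≤
      S.value (s + L) (N + Pi.single e 1 - Pi.single f 1) := by
  induction L generalizing N f f' with
  | zero => simp [run]
  | succ L ih =>
    rw [← Nat.add_assoc]
    let c : V → E := fun v => if f' ∈ S.inc w ∧ v = w ∧ S.best (s + L) N v = f then f'
      else S.best (s + L) N v
    have hc : ∀ v, c v ∈ S.inc v := by
      intro v
      simp only [c]
      split_ifs with h
      · rw [h.2.1]; exact h.1
      · exact S.best_mem _ _ _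
    refine le_trans ?_ (S.average_le_value_succ _ _ c hc)
    simp only [run]
    gcongr with v
    set b := S.best (s + L) N v with hb
    by_cases h : f' ∈ S.inc w ∧ v = w ∧ b = f
    · have hcv : c v = f' := by simp only [c]; rw [if_pos]; exact h
      -- After the deviation the deficit sits at `f'` and pure copying follows; taking both places
      -- equal to `f'` makes the conditional vacuous.
      have h2 := ih (N - Pi.single b 1) f' f'
      simp only [ite_self] at h2
      rw [hcv]
      have e1 : N + Pi.single e 1 - Pi.single f 1 - Pi.single f' 1 =
          N - Pi.single b 1 + Pi.single e 1 - Pi.single f' 1 := by rw [h.2.2]; abel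
      rw [e1]
      refine le_trans (le_of_eq ?_) h2
      congr 1
      funext l
      rw [if_pos ⟨h.1, by simp [h.2.1, h.2.2]⟩, used_cons, sub_sub]
    · have hcv : c v = b := by simp only [c]; rw [if_neg]; exact h
      rw [hcv]
      have e1 : N + Pi.single e 1 - Pi.single f 1 - Pi.single b 1 =
          N - Pi.single b 1 + Pi.single e 1 - Pi.single f 1 := by abel
      rw [e1]
      refine le_trans (le_of_eq ?_) (ih (N - Pi.single b 1) f f')
      congr 1
      funext l
      have h3 : (f' ∈ S.inc w ∧ (w, f) ∈ (v, b) :: l) ↔ (f' ∈ S.inc w ∧ (w, f) ∈ l) := by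
        simp only [List.mem_cons, Prod.mk.injEq]
        constructor
        · rintro ⟨h4, h5 | h5⟩
          · exact absurd ⟨h4, h5.1.symm, h5.2.symm⟩ h
          · exact ⟨h4, h5⟩
        · rintro ⟨h4, h5⟩; exact ⟨h4, Or.inr h5⟩
      simp only [h3, used_cons, sub_sub]

end ChoiceSystem

/-! ### Contraction and binomial anti-concentration -/

/-- An upward closed property of real numbers that improves under contraction towards `a`, up to an
arbitrarily small error, holds for all numbers above `a`. -/
theorem of_contraction {P : ℝ → Prop} {a q c₀ : ℝ} (hq : 0 < q) (hq1 : q ≤ 1)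
    (hmono : ∀ c c', c ≤ c' → P c → P c') (h0 : P c₀)
    (hstep : ∀ c, a ≤ c → P c → ∀ β, 0 < β → P (c - q * (c - a) + β)) {β : ℝ} (hβ : 0 < β) :
    P (a + β) := by
  wlog hc : a < c₀ generalizing c₀
  · exact hmono _ _ (by linarith) h0
  have key : ∀ n : ℕ, P (a + (1 - q / 2) ^ n * (c₀ - a)) := by
    intro n
    induction n with
    | zero => simpa using h0
    | succ n ih =>
      have hp : 0 < (1 - q / 2) ^ n * (c₀ - a) := by
        have : 0 < 1 - q / 2 := by linarith
        have : 0 < c₀ - a := by linarith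
        positivity
      -- Half of the improvement pays for the error, which leaves the contraction factor `1 - q /
      -- 2`.
      have := hstep _ (by linarith) ih (q / 2 * ((1 - q / 2) ^ n * (c₀ - a))) (by positivity)
      refine hmono _ _ (le_of_eq ?_) this
      ring
  have h1 : Tendsto (fun n : ℕ => (1 - q / 2) ^ n * (c₀ - a)) atTop (𝓝 (0 * (c₀ - a))) :=
    (tendsto_pow_atTop_nhds_zero_of_lt_one (by linarith) (by linarith)).mul_const _
  rw [zero_mul] at h1
  obtain ⟨n, hn⟩ := (h1.eventually (gt_mem_nhds hβ)).exists
  exact hmono _ _ (by linarith) (key n)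

/-- The binomial probabilities with parameter `q`, extended by zero to all integers. -/
noncomputable def binom (q : ℝ) : ℕ → ℤ → ℝ
  | 0, j => if j = 0 then 1 else 0
  | L + 1, j => (1 - q) * binom q L j + q * binom q L (j - 1)

section Binom

variable {q : ℝ}

theorem sum_binom_le_one (h0 : 0 ≤ q) (h1 : q ≤ 1) (L : ℕ) (T : Finset ℤ) :
    ∑ j ∈ T, binom q L j ≤ 1 := by
  induction L generalizing T with
  | zero =>
    simp only [binom, Finset.sum_ite_eq']
    split_ifs <;> norm_num
  | succ L ih =>
    simp only [binom, Finset.sum_add_distrib, ← Finset.mul_sum]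
    have h2 := ih (T.image fun j => j - 1)
    rw [Finset.sum_image (by intro a _ b _ h; simpa using h)] at h2
    have := mul_le_mul_of_nonneg_left (ih T) (sub_nonneg.2 h1)
    have := mul_le_mul_of_nonneg_left h2 h0
    linarith

theorem binom_add_le (h0 : 0 ≤ q) (h1 : q ≤ 1) {L : ℕ} {c : ℝ} (hc : ∀ j, binom q L j ≤ c)
    (r : ℕ) (j : ℤ) : binom q (L + r) j ≤ c := by
  induction r generalizing j with
  | zero => exact hc j
  | succ r ih =>
    rw [← Nat.add_assoc, binom]
    have := mul_le_mul_of_nonneg_left (ih j) (sub_nonneg.2 h1)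
    have := mul_le_mul_of_nonneg_left (ih (j - 1)) h0
    linarith

/-- After `r` further trials the probability at `j` is an average of those at `j - i`, `i ≤ r`, with
weights at least `α ^ r`; one small entry therefore lowers the average by a fixed share. -/
theorem binom_add_le_of_small {α : ℝ} (hα : 0 ≤ α) (hαq : α ≤ q) (hα1 : α ≤ 1 - q) {L : ℕ}
    {c x : ℝ} (hx : x ≤ c) (hc : ∀ j, binom q L j ≤ c) (r : ℕ) (j : ℤ)
    (h : ∃ i : ℕ, i ≤ r ∧ binom q L (j - i) ≤ x) :
    binom q (L + r) j ≤ c - α ^ r * (c - x) := by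
  have h0 : 0 ≤ q := hα.trans hαq
  have h1 : q ≤ 1 := by linarith
  induction r generalizing j with
  | zero =>
    obtain ⟨i, hi, h⟩ := h
    obtain rfl : i = 0 := by omega
    simpa using h
  | succ r ih =>
    rw [← Nat.add_assoc, binom]
    obtain ⟨i, hi, h⟩ := h
    have hp : 0 ≤ α ^ r * (c - x) := mul_nonneg (pow_nonneg hα r) (by linarith)
    rcases Nat.lt_or_ge i (r + 1) with hir | hir
    · have h2 := ih j ⟨i, by omega, h⟩
      have h3 := binom_add_le h0 h1 hc r (j - 1)
      have h4 := mul_le_mul_of_nonneg_left h2 (sub_nonneg.2 h1)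
      have h5 := mul_le_mul_of_nonneg_left h3 h0
      have h6 := mul_le_mul_of_nonneg_right hα1 hp
      rw [pow_succ]
      nlinarith
    · obtain rfl : i = r + 1 := by omega
      have h2 := ih (j - 1) ⟨r, le_rfl, by
        have : j - 1 - (r : ℤ) = j - ((r + 1 : ℕ) : ℤ) := by push_cast; ring
        rwa [this]⟩
      have h3 := binom_add_le h0 h1 hc r j
      have h4 := mul_le_mul_of_nonneg_left h3 (sub_nonneg.2 h1)
      have h5 := mul_le_mul_of_nonneg_left h2 h0
      have h6 := mul_le_mul_of_nonneg_right hαq hp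
      rw [pow_succ]
      nlinarith

/-- Binomial probabilities tend to zero uniformly. -/
theorem eventually_binom_le (h0 : 0 < q) (h1 : q < 1) {ε : ℝ} (hε : 0 < ε) :
    ∀ᶠ L in atTop, ∀ j, binom q L j ≤ ε := by
  obtain ⟨r, hr⟩ := exists_nat_one_div_lt (half_pos hε)
  set α := min q (1 - q) with hα
  have hα0 : 0 < α := lt_min h0 (by linarith)
  have key := of_contraction (P := fun c => ∀ᶠ L in atTop, ∀ j, binom q L j ≤ c)
    (a := 1 / ((r : ℝ) + 1)) (q := α ^ r) (c₀ := 1) (pow_pos hα0 r)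
    (pow_le_one₀ hα0.le ((min_le_left _ _).trans h1.le))
    (fun c c' hcc h => h.mono fun L hL j => (hL j).trans hcc)
    (Eventually.of_forall fun L j => by simpa using sum_binom_le_one h0.le h1.le L {j})
    ?_ (half_pos hε)
  · refine key.mono fun L hL j => (hL j).trans ?_
    linarith
  intro c hac hc β hβ
  rw [← map_add_atTop_eq_nat r, eventually_map]
  filter_upwards [hc] with L hL j
  -- The `r + 1` consecutive probabilities sum to at most `1`, so one of them is at most `1 / (r +
  -- 1)`.
  have hsmall : ∃ i : ℕ, i ≤ r ∧ binom q L (j - i) ≤ 1 / ((r : ℝ) + 1) := by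
    by_contra! h
    have h2 := sum_binom_le_one h0.le h1.le L ((Finset.range (r + 1)).image fun i : ℕ => j - i)
    rw [Finset.sum_image (by intro a _ b _ h; simpa using h)] at h2
    have h3 : ∑ i ∈ Finset.range (r + 1), 1 / ((r : ℝ) + 1) <
        ∑ i ∈ Finset.range (r + 1), binom q L (j - i) :=
      Finset.sum_lt_sum_of_nonempty (by simp) fun i hi => h i (by simp at hi; omega)
    have h4 : ∑ i ∈ Finset.range (r + 1), 1 / ((r : ℝ) + 1) = 1 := by
      rw [Finset.sum_const, Finset.card_range, nsmul_eq_mul]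
      push_cast
      field_simp
    linarith
  have := binom_add_le_of_small hα0.le (min_le_left _ _) (min_le_right _ _) hac hL r j hsmall
  linarith

end Binom

/-! ### Counting draws, and the exponential upper bound -/

namespace ChoiceSystem

variable {V E : Type*} [Fintype V] [Fintype E] [DecidableEq V] [DecidableEq E]
  (S : ChoiceSystem V E)

/-- Choices have no influence on later draws, so the count follows the binomial recursion whatever
the play. -/
theorem run_count_eq [Nonempty V] (D : Finset V) (s L : ℕ) (N : E → ℤ) (j : ℤ) :
    S.run s L (fun l => if (l.countP (fun p => p.1 ∈ D) : ℤ) = j then 1 else 0) N =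
      binom ((D.card : ℝ) / Fintype.card V) L j := by
  have hk : (Fintype.card V : ℝ) ≠ 0 := by exact_mod_cast Fintype.card_ne_zero
  induction L generalizing N j with
  | zero => simp [run, binom, eq_comm]
  | succ L ih =>
    have h1 : ∀ v, S.run s L (fun l => if
        ((((v, S.best (s + L) N v) :: l).countP (fun p => p.1 ∈ D) : ℕ) : ℤ) = j then 1 else 0)
        (N - Pi.single (S.best (s + L) N v) 1) =
        if v ∈ D then binom ((D.card : ℝ) / Fintype.card V) L (j - 1)
        else binom ((D.card : ℝ) / Fintype.card V) L j := by
      intro v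
      split_ifs with hv
      · rw [← ih (N - Pi.single (S.best (s + L) N v) 1) (j - 1)]
        congr 1
        funext l
        simp only [List.countP_cons, hv, decide_true, if_true]
        push_cast
        simp only [eq_sub_iff_add_eq]
      · rw [← ih (N - Pi.single (S.best (s + L) N v) 1) j]
        congr 1
        funext l
        simp [hv]
    simp only [run, h1, binom]
    rw [Finset.sum_ite, Finset.sum_const, Finset.sum_const, Finset.filter_mem_eq_inter,
      Finset.univ_inter, nsmul_eq_mul, nsmul_eq_mul]
    have h2 : ((Finset.univ.filter fun v => v ∉ D).card : ℝ) = Fintype.card V - D.card := by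
      have : (Finset.univ.filter fun v => v ∉ D) = Dᶜ := by ext; simp
      rw [this, Finset.card_compl, Nat.cast_sub (Finset.card_le_univ D)]
    rw [h2]
    field_simp
    ring

/-- The number of draws from a nontrivial set is unlikely to lie in a window of given length, if
there are many draws. -/
theorem eventually_run_window_le [Nonempty V] {D : Finset V} (hD : D.Nonempty)
    (hD' : D ≠ Finset.univ) (W : ℕ) {ε : ℝ} (hε : 0 < ε) :
    ∀ᶠ L in atTop, ∀ (s : ℕ) (N : E → ℤ) (a : ℤ),
      S.run s L (fun l => if a ≤ (l.countP (fun p => p.1 ∈ D) : ℤ) ∧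
        (l.countP (fun p => p.1 ∈ D) : ℤ) ≤ a + W then 1 else 0) N ≤ ε := by
  have hk : (0 : ℝ) < Fintype.card V := by exact_mod_cast Fintype.card_pos
  have h0 : 0 < (D.card : ℝ) / Fintype.card V :=
    div_pos (by exact_mod_cast hD.card_pos) hk
  have h1 : (D.card : ℝ) / Fintype.card V < 1 := by
    rw [div_lt_one hk]
    exact_mod_cast (Finset.card_lt_iff_ne_univ D).2 hD'
  have hW : (0 : ℝ) < W + 1 := by positivity
  filter_upwards [eventually_binom_le h0 h1 (div_pos hε hW)] with L hL s N a
  have h2 : ∀ l : List (V × E), (if a ≤ (l.countP (fun p => p.1 ∈ D) : ℤ) ∧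
      (l.countP (fun p => p.1 ∈ D) : ℤ) ≤ a + W then (1 : ℝ) else 0) =
      ∑ j ∈ Finset.Icc a (a + W), if (l.countP (fun p => p.1 ∈ D) : ℤ) = j then (1 : ℝ) else 0 := by
    intro l
    rw [Finset.sum_ite_eq]
    simp only [Finset.mem_Icc]
  simp only [h2]
  rw [run_sum]
  simp only [run_count_eq]
  calc ∑ j ∈ Finset.Icc a (a + W), binom ((D.card : ℝ) / Fintype.card V) L j
      ≤ ∑ _j ∈ Finset.Icc a (a + (W : ℤ)), ε / (W + 1) := Finset.sum_le_sum fun j _ => hL j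
    _ = ε := by
      rw [Finset.sum_const, Int.card_Icc, nsmul_eq_mul]
      have : (a + W + 1 - a).toNat = W + 1 := by omega
      rw [this]
      push_cast
      field_simp

/-- The points of `V` all of whose choices lie in `F`. -/
def full (F : Finset E) : Finset V := Finset.univ.filter fun v => S.inc v ⊆ F

theorem mem_full {F : Finset E} {v : V} : v ∈ S.full F ↔ S.inc v ⊆ F := by simp [full]

theorem sum_sub_single (F : Finset E) (N : E → ℤ) (e : E) :
    ∑ f ∈ F, (N - Pi.single e 1 : E → ℤ) f = ∑ f ∈ F, N f - if e ∈ F then 1 else 0 := by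
  simp only [Pi.sub_apply, Finset.sum_sub_distrib]
  congr 1
  simp [Pi.single_apply]

/-- Chernoff bound: a draw from `full F` multiplies the exponential of `θ` times the total on `F` by
`exp (-θ)`, any other draw does not increase it, and a win ends with exponential `1`. The base of
the power is the expected factor. -/
theorem value_le_exp_mul_pow [Nonempty V] (F : Finset E) {θ : ℝ} (hθ : 0 ≤ θ) (t : ℕ)
    (N : E → ℤ) : S.value t N ≤ Real.exp (θ * (∑ e ∈ F, N e : ℤ)) *
      (1 - (S.full F).card / Fintype.card V * (1 - Real.exp (-θ))) ^ t := by
  have hk : (0 : ℝ) < Fintype.card V := by exact_mod_cast Fintype.card_pos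
  set φ : ℝ := 1 - (S.full F).card / Fintype.card V * (1 - Real.exp (-θ)) with hφ
  have hφ' : (∑ v, if v ∈ S.full F then Real.exp (-θ) else 1) / Fintype.card V = φ := by
    rw [Finset.sum_ite, Finset.sum_const, Finset.sum_const, Finset.filter_mem_eq_inter,
      Finset.univ_inter, nsmul_eq_mul, nsmul_eq_mul]
    have h2 : ((Finset.univ.filter fun v => v ∉ S.full F).card : ℝ) =
        Fintype.card V - (S.full F).card := by
      have : (Finset.univ.filter fun v => v ∉ S.full F) = (S.full F)ᶜ := by ext; simp
      rw [this, Finset.card_compl, Nat.cast_sub (Finset.card_le_univ _)]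
    rw [h2, hφ]
    field_simp
    ring
  have hφ0 : 0 ≤ φ := by
    rw [← hφ']
    refine div_nonneg (Finset.sum_nonneg fun v _ => ?_) hk.le
    split_ifs <;> positivity
  induction t generalizing N with
  | zero =>
    rw [value]
    split_ifs with h
    · subst h; simp
    · simp; positivity
  | succ t ih =>
    have hsum : Real.exp (θ * (∑ e ∈ F, N e : ℤ)) * φ ^ (t + 1) =
        (∑ v, Real.exp (θ * (∑ e ∈ F, N e : ℤ)) *
          (φ ^ t * if v ∈ S.full F then Real.exp (-θ) else 1)) / Fintype.card V := by
      rw [← Finset.mul_sum, ← Finset.mul_sum, pow_succ, mul_div_assoc, mul_div_assoc, hφ']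
    rw [value_succ, hsum]
    gcongr with v
    refine (ih _).trans ?_
    rw [mul_comm (φ ^ t), ← mul_assoc]
    gcongr
    rw [sum_sub_single]
    split_ifs with h1 h2 h2
    · rw [← Real.exp_add]
      apply le_of_eq
      push_cast
      ring_nf
    · rw [mul_one]
      gcongr
      linarith
    · exact absurd (S.mem_full.1 h2 (S.best_mem _ _ _)) h1
    · simp

/-- The chance to win is exponentially small if `F` has to be chosen too often. -/
theorem value_le_exp [Nonempty V] (F : Finset E) {ε a : ℝ} (hε : 0 < ε) (hε1 : ε ≤ 1) (t : ℕ)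
    (N : E → ℤ) (h : ((∑ e ∈ F, N e : ℤ) : ℝ) ≤
      t * ((S.full F).card / Fintype.card V - ε) + a) :
    S.value t N ≤ Real.exp (ε / 2 * a) * Real.exp (-(ε ^ 2 / 4) * t) := by
  have hk : (0 : ℝ) < Fintype.card V := by exact_mod_cast Fintype.card_pos
  set q : ℝ := (S.full F).card / Fintype.card V with hq
  have hq0 : 0 ≤ q := by positivity
  have hq1 : q ≤ 1 := by
    rw [hq, div_le_one hk]
    exact_mod_cast Finset.card_le_univ _
  -- With parameter `θ` the exponent per round is at most `θ ^ 2 - θ * ε`; it is minimal at `θ = ε /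
  -- 2`.
  refine (S.value_le_exp_mul_pow F (half_pos hε).le t N).trans ?_
  have h1 : Real.exp (-(ε / 2)) ≤ 1 - ε / 2 + (ε / 2) ^ 2 := by
    have := Real.abs_exp_sub_one_sub_id_le (x := -(ε / 2))
      (by rw [abs_neg, abs_of_pos (half_pos hε)]; linarith)
    have := (abs_le.1 this).2
    linarith
  have h1' : Real.exp (-(ε / 2)) ≤ 1 := by
    rw [Real.exp_le_one_iff]; linarith
  have h2 : 1 - q * (1 - Real.exp (-(ε / 2))) ≤ Real.exp (-q * (ε / 2) + (ε / 2) ^ 2) := by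
    refine le_trans ?_ (Real.add_one_le_exp _)
    have := mul_le_mul_of_nonneg_left h1 hq0
    have := mul_le_mul_of_nonneg_right hq1 (sq_nonneg (ε / 2))
    linarith
  have h3 : 0 ≤ 1 - q * (1 - Real.exp (-(ε / 2))) := by
    have := Real.exp_pos (-(ε / 2))
    have := mul_le_mul hq1 (by linarith : 1 - Real.exp (-(ε / 2)) ≤ 1) (by linarith) zero_le_one
    linarith
  calc _ ≤ Real.exp (ε / 2 * (t * (q - ε) + a)) * Real.exp (-q * (ε / 2) + (ε / 2) ^ 2) ^ t := by
        gcongr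
    _ = _ := by
        rw [← Real.exp_nat_mul, ← Real.exp_add, ← Real.exp_add]
        congr 1
        ring

/-! ### Margins and greedy steering -/

/-- The distribution `y` gives every nontrivial set `F` at least `δ` more than the share of the
draws that have to be answered in `F`. -/
def HasMargin (δ : ℝ) (y : E → ℝ) : Prop :=
  ∀ F : Finset E, F.Nonempty → F ≠ Finset.univ →
    ((S.full F).card : ℝ) / Fintype.card V + δ ≤ ∑ e ∈ F, y e

/-- The drift of greedy choices, for a weight `Δ`, against a distribution with margin. -/
theorem HasMargin.greedy_drift [Nonempty V] {S : ChoiceSystem V E} {δ : ℝ} (hδ : 0 ≤ δ)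
    {y : E → ℝ} (hm : S.HasMargin δ y) (hy : ∑ e, y e = 1) (g : V → E) (Δ : E → ℝ)
    (hmax : ∀ v, ∀ e ∈ S.inc v, Δ e ≤ Δ (g v)) (a b : E) :
    Fintype.card V * (δ * (Δ a - Δ b)) ≤ ∑ v, Δ (g v) - Fintype.card V * ∑ e, y e * Δ e := by
  have hk : (0 : ℝ) < Fintype.card V := by exact_mod_cast Fintype.card_pos
  -- Induction on the number of values of `Δ`: raise the lowest level set `A` to the second lowest
  -- level. The sum of maxima grows only through draws from `full A`, the average grows by the mass
  -- of `A`, and the margin compares the two.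
  induction hn : (Finset.univ.image Δ).card using Nat.strong_induction_on generalizing Δ with
  | _ n ih =>
    obtain ⟨e₀, -, he₀⟩ := Finset.exists_min_image Finset.univ Δ ⟨a, Finset.mem_univ a⟩
    set A : Finset E := Finset.univ.filter fun e => Δ e = Δ e₀ with hA
    by_cases hAu : A = Finset.univ
    · have hc : ∀ e, Δ e = Δ e₀ := fun e => by
        have : e ∈ A := hAu ▸ Finset.mem_univ e
        simpa [hA] using this
      simp only [hc a, hc b, hc]
      rw [← Finset.sum_mul, hy]
      simp
    · have hne : (Finset.univ.filter fun e => Δ e ≠ Δ e₀).Nonempty := by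
        by_contra h
        rw [Finset.not_nonempty_iff_eq_empty, Finset.filter_eq_empty_iff] at h
        refine hAu (Finset.eq_univ_iff_forall.2 fun e => ?_)
        simpa [hA] using h (Finset.mem_univ e)
      obtain ⟨e₁, h1, he₁⟩ := Finset.exists_min_image _ Δ hne
      have h1' : Δ e₁ ≠ Δ e₀ := by simpa using h1
      have h01 : Δ e₀ < Δ e₁ := lt_of_le_of_ne (he₀ _ (Finset.mem_univ _)) (Ne.symm h1')
      set Δ' : E → ℝ := fun e => max (Δ e) (Δ e₁) with hΔ'
      have hin : ∀ e, e ∈ A → Δ' e = Δ e + (Δ e₁ - Δ e₀) := fun e he => by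
        have : Δ e = Δ e₀ := by simpa [hA] using he
        simp only [hΔ', this, max_eq_right h01.le]; ring
      have hout : ∀ e, e ∉ A → Δ' e = Δ e := fun e he => by
        have : Δ e ≠ Δ e₀ := by simpa [hA] using he
        exact max_eq_left (he₁ e (by simpa using this))
      have hcard : (Finset.univ.image Δ').card < n := by
        rw [← hn]
        refine Finset.card_lt_card (Finset.ssubset_iff.2 ⟨Δ e₀, ?_, ?_⟩)
        · simp only [Finset.mem_image, Finset.mem_univ, true_and, not_exists]
          intro e he
          have : Δ e₁ ≤ Δ' e := le_max_right _ _
          linarith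
        · refine Finset.insert_subset (Finset.mem_image_of_mem _ (Finset.mem_univ _)) ?_
          intro x hx
          obtain ⟨e, -, rfl⟩ := Finset.mem_image.1 hx
          rcases max_choice (Δ e) (Δ e₁) with h | h
          · simp only [hΔ', h]; exact Finset.mem_image_of_mem _ (Finset.mem_univ _)
          · simp only [hΔ', h]; exact Finset.mem_image_of_mem _ (Finset.mem_univ _)
      have hih := ih _ hcard Δ' (fun v e he => max_le_max_right _ (hmax v e he)) rfl
      have hs1 : ∑ v, Δ' (g v) ≤ ∑ v, Δ (g v) + (S.full A).card * (Δ e₁ - Δ e₀) := by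
        have : ∀ v, Δ' (g v) ≤ Δ (g v) + if v ∈ S.full A then Δ e₁ - Δ e₀ else 0 := by
          intro v
          by_cases hv : g v ∈ A
          · have hfull : v ∈ S.full A := S.mem_full.2 fun e he => by
              have h2 : Δ (g v) = Δ e₀ := by simpa [hA] using hv
              have h3 := hmax v e he
              have h4 := he₀ e (Finset.mem_univ _)
              simp only [hA, Finset.mem_filter, Finset.mem_univ, true_and]
              linarith
            rw [if_pos hfull, hin _ hv]
          · rw [hout _ hv]
            split_ifs <;> linarith
        refine (Finset.sum_le_sum fun v _ => this v).trans (le_of_eq ?_)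
        rw [Finset.sum_add_distrib, Finset.sum_ite_mem, Finset.univ_inter, Finset.sum_const,
          nsmul_eq_mul]
      have hs2 : ∑ e, y e * Δ' e = ∑ e, y e * Δ e + (Δ e₁ - Δ e₀) * ∑ e ∈ A, y e := by
        have : ∀ e, y e * Δ' e = y e * Δ e + if e ∈ A then (Δ e₁ - Δ e₀) * y e else 0 := by
          intro e
          split_ifs with he
          · rw [hin _ he]; ring
          · rw [hout _ he]; ring
        rw [Finset.sum_congr rfl fun e _ => this e, Finset.sum_add_distrib, Finset.sum_ite_mem,
          Finset.univ_inter, Finset.mul_sum]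
      have hmA := hm A ⟨e₀, by simp [hA]⟩ hAu
      have hmA' : (S.full A).card + Fintype.card V * δ ≤ Fintype.card V * ∑ e ∈ A, y e := by
        have := mul_le_mul_of_nonneg_left hmA hk.le
        rwa [mul_add, mul_div_cancel₀ _ hk.ne'] at this
      have hab : Δ a - Δ b ≤ (Δ' a - Δ' b) + (Δ e₁ - Δ e₀) := by
        have h2 : Δ a ≤ Δ' a := le_max_left _ _
        have h3 : Δ' b ≤ Δ b + (Δ e₁ - Δ e₀) := by
          have := he₀ b (Finset.mem_univ _)
          exact max_le (by linarith) (by linarith)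
        linarith
      have h5 := mul_le_mul_of_nonneg_left (mul_le_mul_of_nonneg_left hab hδ) hk.le
      have h6 := mul_le_mul_of_nonneg_left hmA' (sub_nonneg.2 h01.le)
      rw [hs2] at hih
      linarith

theorem sqrt_add_le {x u : ℝ} (hx : 1 ≤ x) (hxu : 1 ≤ x + u) :
    √(x + u) ≤ √x + u / (2 * √x) := by
  have hV : 0 < √x := Real.sqrt_pos.2 (by linarith)
  have hsq : √x * √x = x := Real.mul_self_sqrt (by linarith)
  have h1 : u / (2 * √x) * (2 * √x) = u := div_mul_cancel₀ _ (by positivity)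
  have h2 : 0 ≤ √x + u / (2 * √x) := by
    have : 0 ≤ (√x + u / (2 * √x)) * (2 * √x) := by
      rw [add_mul, h1]; nlinarith
    exact nonneg_of_mul_nonneg_left this (by positivity)
  rw [Real.sqrt_le_left h2]
  nlinarith [sq_nonneg (u / (2 * √x))]

/-- The Lyapunov function of greedy play. -/
noncomputable def height (Δ : E → ℝ) : ℝ := √(1 + ∑ e, Δ e ^ 2)

theorem one_le_height (Δ : E → ℝ) : 1 ≤ height Δ := by
  rw [height, Real.one_le_sqrt]
  have := Finset.sum_nonneg fun e (_ : e ∈ Finset.univ) => sq_nonneg (Δ e)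
  linarith

theorem abs_le_height (Δ : E → ℝ) (e : E) : |Δ e| ≤ height Δ := by
  rw [height]
  refine Real.abs_le_sqrt ?_
  have := Finset.single_le_sum (f := fun e => Δ e ^ 2) (fun e _ => sq_nonneg (Δ e))
    (Finset.mem_univ e)
  linarith

theorem abs_sum_mul_le_height (Δ ξ : E → ℝ) (hξ : ∀ e, |ξ e| ≤ 1) :
    |∑ e, Δ e * ξ e| ≤ Fintype.card E * height Δ := by
  calc |∑ e, Δ e * ξ e| ≤ ∑ e, |Δ e * ξ e| := Finset.abs_sum_le_sum_abs _ _
    _ ≤ ∑ _e : E, height Δ := Finset.sum_le_sum fun e _ => by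
        rw [abs_mul]
        have := mul_le_mul (abs_le_height Δ e) (hξ e) (abs_nonneg _)
          (zero_le_one.trans (one_le_height Δ))
        linarith
    _ = _ := by simp

/-- The square root turns the linear drift of the squared norm into a drift of constant order, with
an error that vanishes for large height; the increments stay bounded, so exponential moments can be
controlled. -/
theorem height_add_le (Δ ξ : E → ℝ) (hξ : ∀ e, |ξ e| ≤ 1) :
    height (Δ + ξ) ≤ height Δ + (2 * ∑ e, Δ e * ξ e + Fintype.card E) / (2 * height Δ) := by
  have h1 : ∑ e, ξ e ^ 2 ≤ Fintype.card E := by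
    calc ∑ e, ξ e ^ 2 ≤ ∑ _e : E, (1 : ℝ) := Finset.sum_le_sum fun e _ => by
          rw [← sq_abs]; exact pow_le_one₀ (abs_nonneg _) (hξ e)
      _ = _ := by simp
  have h2 : 1 + ∑ e, (Δ + ξ) e ^ 2 =
      1 + ∑ e, Δ e ^ 2 + (2 * ∑ e, Δ e * ξ e + ∑ e, ξ e ^ 2) := by
    rw [Finset.mul_sum, add_assoc, ← Finset.sum_add_distrib, ← Finset.sum_add_distrib]
    congr 1
    refine Finset.sum_congr rfl fun e _ => ?_
    simp only [Pi.add_apply]; ring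
  have h3 := Finset.sum_nonneg fun e (_ : e ∈ Finset.univ) => sq_nonneg (Δ e)
  have h4 := Finset.sum_nonneg fun e (_ : e ∈ Finset.univ) => sq_nonneg ((Δ + ξ) e)
  have h5 := one_le_height Δ
  calc height (Δ + ξ) ≤ height Δ +
        (2 * ∑ e, Δ e * ξ e + ∑ e, ξ e ^ 2) / (2 * height Δ) := by
        rw [height, h2]
        exact sqrt_add_le (by linarith) (by linarith)
    _ ≤ _ := by gcongr

/-- Greedy play contracts the exponential of the height, up to a constant. -/
theorem HasMargin.exp_height_drift [Nonempty V] [Nonempty E] {S : ChoiceSystem V E} {δ : ℝ}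
    (hδ : 0 < δ) (hδ1 : δ ≤ 1) {y : E → ℝ} (hm : S.HasMargin δ y) (hy : ∑ e, y e = 1)
    (hy01 : ∀ e, 0 ≤ y e ∧ y e ≤ 1) (g : V → E) (Δ : E → ℝ)
    (hΔ : ∑ e, Δ e = 0) (hmax : ∀ v, ∀ e ∈ S.inc v, Δ e ≤ Δ (g v)) {m θ : ℝ}
    (hmE : m = Fintype.card E) (hθ : θ = δ / (16 * m ^ 3)) :
    (∑ v, Real.exp (θ * height (Δ + (y - Pi.single (g v) 1)))) / Fintype.card V ≤
      (1 - θ * δ / (4 * m)) * Real.exp (θ * height Δ) +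
        Real.exp (θ * (2 + m ^ 2 / δ + 2 * m)) := by
  have hk : (0 : ℝ) < Fintype.card V := by exact_mod_cast Fintype.card_pos
  have hm1 : 1 ≤ m := by rw [hmE]; exact_mod_cast Fintype.card_pos
  have hθ0 : 0 < θ := by rw [hθ]; positivity
  set h := height Δ with hh
  have h1 : 1 ≤ h := one_le_height Δ
  set ξ : V → E → ℝ := fun v => y - Pi.single (g v) 1 with hξ
  have hξ1 : ∀ v e, |ξ v e| ≤ 1 := by
    intro v e
    have := hy01 e
    rw [abs_le]
    by_cases he : e = g v
    · subst he; simp [hξ]; constructor <;> linarith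
    · simp [hξ, Pi.single_eq_of_ne he]; constructor <;> linarith
  set X : V → ℝ := fun v => (2 * ∑ e, Δ e * ξ v e + m) / (2 * h) with hX
  have hXle : ∀ v, height (Δ + ξ v) ≤ h + X v := by
    intro v
    simp only [hX, hmE]
    exact height_add_le Δ (ξ v) (hξ1 v)
  have hXabs : ∀ v, |X v| ≤ 2 * m := by
    intro v
    have h2 := abs_sum_mul_le_height Δ (ξ v) (hξ1 v)
    rw [← hmE, ← hh] at h2
    have h3 := abs_le.1 h2
    simp only [hX]
    rw [abs_div, abs_of_pos (by positivity : 0 < 2 * h), div_le_iff₀ (by positivity), abs_le]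
    constructor <;> nlinarith
  have hρ : 0 ≤ 1 - θ * δ / (4 * m) := by
    have h2 : θ ≤ 1 := by
      rw [hθ, div_le_one (by positivity)]
      have := one_le_pow₀ hm1 (n := 3)
      linarith
    rw [sub_nonneg, div_le_one (by positivity)]
    nlinarith
  -- Below this threshold bounded increments suffice and give the additive constant. Above it the
  -- second-order term `m` is absorbed, leaving mean increment at most `-(δ / (2 * m))`.
  rcases le_total h (2 + m ^ 2 / δ) with hsmall | hlarge
  · refine le_add_of_nonneg_of_le (by positivity) (average_le_of_le fun v => ?_)
    refine Real.exp_le_exp.2 (mul_le_mul_of_nonneg_left ?_ hθ0.le)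
    have := hXle v
    have := (abs_le.1 (hXabs v)).2
    linarith
  · refine le_add_of_le_of_nonneg ?_ (Real.exp_pos _).le
    have hexp : ∀ v, Real.exp (θ * height (Δ + ξ v)) ≤
        Real.exp (θ * h) * (1 + θ * X v + θ ^ 2 * (4 * m ^ 2)) := by
      intro v
      have habs := hXabs v
      have h2 : Real.exp (θ * X v) ≤ 1 + θ * X v + θ ^ 2 * (4 * m ^ 2) := by
        have h3 : |θ * X v| ≤ 1 := by
          rw [abs_mul, abs_of_pos hθ0]
          calc θ * |X v| ≤ θ * (2 * m) := by gcongr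
            _ ≤ 1 := by
              rw [hθ, div_mul_eq_mul_div, div_le_one (by positivity)]
              have : m ≤ m ^ 3 := le_self_pow₀ hm1 (by norm_num)
              nlinarith
        have h4 := (abs_le.1 (Real.abs_exp_sub_one_sub_id_le h3)).2
        have h5 : X v ^ 2 ≤ (2 * m) ^ 2 := by
          rw [← sq_abs]; gcongr
        have h6 := mul_le_mul_of_nonneg_left h5 (sq_nonneg θ)
        nlinarith
      calc Real.exp (θ * height (Δ + ξ v)) ≤ Real.exp (θ * (h + X v)) :=
            Real.exp_le_exp.2 (mul_le_mul_of_nonneg_left (hXle v) hθ0.le)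
        _ = Real.exp (θ * h) * Real.exp (θ * X v) := by rw [mul_add, Real.exp_add]
        _ ≤ _ := by gcongr
    have hsumX : (∑ v, X v) / Fintype.card V ≤ -(δ / (2 * m)) := by
      obtain ⟨a, -, ha⟩ := Finset.exists_max_image Finset.univ Δ Finset.univ_nonempty
      obtain ⟨b, -, hb⟩ := Finset.exists_min_image Finset.univ Δ Finset.univ_nonempty
      have hdr := hm.greedy_drift hδ.le hy g Δ hmax a b
      have ha0 : 0 ≤ Δ a := by
        by_contra hneg
        have : ∑ e, Δ e < 0 := Finset.sum_neg (fun e he => (ha e he).trans_lt (not_le.1 hneg))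
          Finset.univ_nonempty
        linarith
      have hb0 : Δ b ≤ 0 := by
        by_contra hneg
        have : 0 < ∑ e, Δ e := Finset.sum_pos (fun e he => (not_le.1 hneg).trans_le (hb e he))
          Finset.univ_nonempty
        linarith
      set R := Δ a - Δ b with hR
      have hR0 : 0 ≤ R := by linarith
      -- Since `Δ` sums to zero, `0` lies between its extremes, so all entries are bounded by the
      -- range `R`.
      have hhR : h ≤ 1 + m * R := by
        rw [hh, height, Real.sqrt_le_left (by positivity)]
        have : ∑ e, Δ e ^ 2 ≤ m * R ^ 2 := by
          calc ∑ e, Δ e ^ 2 ≤ ∑ _e : E, R ^ 2 := Finset.sum_le_sum fun e _ => by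
                have h2 := ha e (Finset.mem_univ _)
                have h3 := hb e (Finset.mem_univ _)
                rw [sq_le_sq, abs_of_nonneg hR0, abs_le]
                constructor <;> linarith
            _ = _ := by simp [hmE]
        have h2 : 0 ≤ m * R := by positivity
        have h3 : m * R ^ 2 ≤ m * (m * R ^ 2) := le_mul_of_one_le_left (by positivity) hm1
        linarith [show (1 + m * R) ^ 2 = 1 + 2 * (m * R) + m * (m * R ^ 2) by ring]
      have hsum2 : ∑ v, ∑ e, Δ e * ξ v e =
          Fintype.card V * ∑ e, y e * Δ e - ∑ v, Δ (g v) := by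
        have : ∀ v, ∑ e, Δ e * ξ v e = ∑ e, y e * Δ e - Δ (g v) := by
          intro v
          simp only [hξ, Pi.sub_apply, mul_sub, Finset.sum_sub_distrib]
          congr 1
          · exact Finset.sum_congr rfl fun e _ => mul_comm _ _
          · simp [Pi.single_apply]
        rw [Finset.sum_congr rfl fun v _ => this v, Finset.sum_sub_distrib]
        simp
      have hsum3 : ∑ v, X v = (2 * ∑ v, ∑ e, Δ e * ξ v e + Fintype.card V * m) / (2 * h) := by
        simp only [hX]
        rw [← Finset.sum_div, Finset.sum_add_distrib, ← Finset.mul_sum]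
        simp
      rw [hsum3, div_le_iff₀ hk, div_le_iff₀ (by positivity), hsum2]
      have h7 : m - 2 * (δ * R) ≤ -(δ / (2 * m)) * (2 * h) := by
        have h8 : δ * (h - 1) ≤ δ * (m * R) := by gcongr; linarith
        have h9 : 2 * δ + m ^ 2 ≤ δ * h := by
          have := mul_le_mul_of_nonneg_left hlarge hδ.le
          rwa [mul_add, mul_div_cancel₀ _ hδ.ne', mul_comm δ 2] at this
        have h10 : -(δ / (2 * m)) * (2 * h) = -(δ * h) / m := by field_simp
        rw [h10, le_div_iff₀ (by positivity)]
        nlinarith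
      have h11 := mul_le_mul_of_nonneg_left h7 hk.le
      linarith
    calc (∑ v, Real.exp (θ * height (Δ + ξ v))) / Fintype.card V
        ≤ (∑ v, Real.exp (θ * h) * (1 + θ * X v + θ ^ 2 * (4 * m ^ 2))) / Fintype.card V := by
          gcongr with v; exact hexp v
      _ = Real.exp (θ * h) *
          (1 + θ * ((∑ v, X v) / Fintype.card V) + θ ^ 2 * (4 * m ^ 2)) := by
          rw [← Finset.mul_sum, Finset.sum_add_distrib, Finset.sum_add_distrib, ← Finset.mul_sum]
          simp only [Finset.sum_const, Finset.card_univ, nsmul_eq_mul]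
          field_simp
      _ ≤ Real.exp (θ * h) * (1 + θ * (-(δ / (2 * m))) + θ ^ 2 * (4 * m ^ 2)) := by gcongr
      _ = _ := by
          -- `θ` is chosen so that the quadratic term is exactly half of the linear drift.
          have h12 : θ ^ 2 * (4 * m ^ 2) = θ * δ / (4 * m) := by
            nth_rewrite 1 [hθ]
            rw [sq, hθ]
            field_simp
            ring
          rw [h12, mul_comm]
          congr 1
          field_simp
          ring

theorem HasMargin.nonneg_and_le_one [Nontrivial E] {S : ChoiceSystem V E} {δ : ℝ} (hδ : 0 ≤ δ)
    {y : E → ℝ} (hm : S.HasMargin δ y) (hy : ∑ e, y e = 1) (e : E) : 0 ≤ y e ∧ y e ≤ 1 := by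
  have h0 : ∀ e, 0 ≤ y e := fun e => by
    have hne : ({e} : Finset E) ≠ Finset.univ := by
      intro h
      obtain ⟨f, hf⟩ := exists_ne e
      have := h ▸ Finset.mem_univ f
      exact hf (by simpa using this)
    have h1 := hm {e} (by simp) hne
    rw [Finset.sum_singleton] at h1
    have : 0 ≤ ((S.full {e}).card : ℝ) / Fintype.card V := by positivity
    linarith
  refine ⟨h0 e, ?_⟩
  rw [← hy]
  exact Finset.single_le_sum (fun e _ => h0 e) (Finset.mem_univ e)

/-- Greedy play reaches a bounded neighbourhood of a target state with high probability, if the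
displacement has margin. -/
theorem exists_steering_radius [Nonempty V] [Nontrivial E] {δ : ℝ} (hδ : 0 < δ) (hδ1 : δ ≤ 1)
    {ε : ℝ} (hε : 0 < ε) : ∃ B : ℕ, ∀ (t L : ℕ) (N N₁ : E → ℤ) (c : ℝ), 0 < L → 0 ≤ c →
      ∑ e, N e = t + L → ∑ e, N₁ e = t →
      S.HasMargin δ (fun e => ((N e : ℝ) - N₁ e) / L) →
      (∀ N' : E → ℤ, ∑ e, N' e = t → (∀ e, |N' e - N₁ e| ≤ B) → c ≤ S.value t N') →
      c * (1 - ε) ≤ S.value (t + L) N := by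
  obtain ⟨m, hmE⟩ : ∃ m : ℝ, m = Fintype.card E := ⟨_, rfl⟩
  have hm1 : 1 ≤ m := by rw [hmE]; exact_mod_cast Fintype.card_pos
  obtain ⟨θ, hθ⟩ : ∃ θ : ℝ, θ = δ / (16 * m ^ 3) := ⟨_, rfl⟩
  have hθ0 : 0 < θ := by rw [hθ]; positivity
  have hθ1 : θ ≤ 1 := by
    rw [hθ, div_le_one (by positivity)]
    have := one_le_pow₀ hm1 (n := 3)
    linarith
  obtain ⟨ρ, hρ⟩ : ∃ ρ : ℝ, ρ = 1 - θ * δ / (4 * m) := ⟨_, rfl⟩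
  have hρ1 : ρ < 1 := by rw [hρ]; linarith [show 0 < θ * δ / (4 * m) by positivity]
  have hρ0 : 0 ≤ ρ := by
    rw [hρ, sub_nonneg, div_le_one (by positivity)]
    nlinarith
  -- `K` is the fixed point of the affine recursion given by `exp_height_drift`.
  obtain ⟨K, hK⟩ : ∃ K : ℝ, K * (1 - ρ) = Real.exp (θ * (2 + m ^ 2 / δ + 2 * m)) :=
    ⟨_, div_mul_cancel₀ _ (by linarith)⟩
  have hK0 : 0 ≤ K := by
    refine nonneg_of_mul_nonneg_left ?_ (sub_pos.2 hρ1)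
    rw [hK]; positivity
  -- Markov's inequality: the exponential moment is at most `exp θ + K` whatever the distance, so
  -- `B` does not depend on `t` or `L`.
  obtain ⟨B, hB⟩ : ∃ B : ℕ, Real.exp (-(θ * B)) * (Real.exp θ + K) ≤ ε := by
    have h1 : Tendsto (fun B : ℕ => Real.exp (-(θ * B)) * (Real.exp θ + K)) atTop
        (𝓝 (0 * (Real.exp θ + K))) := by
      refine Tendsto.mul_const _ (Real.tendsto_exp_neg_atTop_nhds_zero.comp ?_)
      exact tendsto_natCast_atTop_atTop.const_mul_atTop hθ0
    rw [zero_mul] at h1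
    exact (h1.eventually (ge_mem_nhds hε)).exists
  refine ⟨B, fun t L N N₁ c hL hc hN hN₁ hmar hnear => ?_⟩
  have hL' : (0 : ℝ) < L := by exact_mod_cast hL
  set y : E → ℝ := fun e => ((N e : ℝ) - N₁ e) / L with hydef
  have hN₁' : ∑ e, (N₁ e : ℝ) = t := by exact_mod_cast hN₁
  have hN' : ∑ e, (N e : ℝ) = t + L := by exact_mod_cast hN
  have hy : ∑ e, y e = 1 := by
    simp only [hydef]
    rw [← Finset.sum_div, Finset.sum_sub_distrib, hN', hN₁']
    field_simp
    ring
  -- Deviation, with `j` rounds left before the target, from the line joining `N₁` to `N`; it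
  -- vanishes at the start `j = L`.
  set Δ : ℕ → (E → ℤ) → E → ℝ := fun j M e => (M e : ℝ) - N₁ e - j * y e with hΔ
  have key : ∀ (j : ℕ) (M : E → ℤ), ∑ e, M e = t + j →
      c * (1 - Real.exp (-(θ * B)) *
        (ρ ^ j * Real.exp (θ * height (Δ j M)) + K * (1 - ρ ^ j))) ≤ S.value (t + j) M := by
    intro j
    induction j with
    | zero =>
      intro M hM
      simp only [pow_zero, one_mul, sub_self, mul_zero, add_zero]
      rw [← Real.exp_add]
      by_cases h : ∀ e, |M e - N₁ e| ≤ B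
      · refine le_trans ?_ (hnear M (by simpa using hM) h)
        refine mul_le_of_le_one_right hc ?_
        linarith [Real.exp_pos (-(θ * B) + θ * height (Δ 0 M))]
      · push Not at h
        obtain ⟨e, he⟩ := h
        refine le_trans ?_ (S.value_nonneg _ _)
        refine mul_nonpos_of_nonneg_of_nonpos hc ?_
        rw [sub_nonpos, Real.one_le_exp_iff]
        have h1 := abs_le_height (Δ 0 M) e
        have h2 : (B : ℝ) ≤ |Δ 0 M e| := by
          simp only [hΔ, Nat.cast_zero, zero_mul, sub_zero]
          exact_mod_cast he.le
        have := mul_le_mul_of_nonneg_left (h2.trans h1) hθ0.le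
        linarith
    | succ j ih =>
      intro M hM
      have hex : ∀ v, ∃ e ∈ S.inc v, ∀ f ∈ S.inc v, Δ (j + 1) M f ≤ Δ (j + 1) M e := fun v =>
        Finset.exists_max_image _ _ (S.nonempty v)
      choose g hg hmax using hex
      have hMr : ∑ e, (M e : ℝ) = t + (j + 1) := by exact_mod_cast hM
      have hΔ0 : ∑ e, Δ (j + 1) M e = 0 := by
        simp only [hΔ]
        rw [Finset.sum_sub_distrib, Finset.sum_sub_distrib, ← Finset.mul_sum, hy, hMr, hN₁']
        push_cast
        ring
      have hdr := hmar.exp_height_drift hδ hδ1 hy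
        (hmar.nonneg_and_le_one hδ.le hy) g (Δ (j + 1) M) hΔ0 hmax hmE hθ
      rw [← hρ, ← hK] at hdr
      have hstep : ∀ v, Δ j (M - Pi.single (g v) 1) =
          Δ (j + 1) M + (y - Pi.single (g v) 1) := by
        intro v
        funext e
        by_cases he : e = g v
        · subst he; simp [hΔ]; ring
        · simp [hΔ, Pi.single_eq_of_ne he]; ring
      rw [← Nat.add_assoc]
      refine le_trans ?_ (S.average_le_value_succ _ _ g hg)
      have hk : (0 : ℝ) < Fintype.card V := by exact_mod_cast Fintype.card_pos
      have hsum : (∑ v, c * (1 - Real.exp (-(θ * B)) *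
          (ρ ^ j * Real.exp (θ * height (Δ (j + 1) M + (y - Pi.single (g v) 1))) +
            K * (1 - ρ ^ j)))) / Fintype.card V =
          c * (1 - Real.exp (-(θ * B)) * (ρ ^ j * ((∑ v, Real.exp (θ * height
            (Δ (j + 1) M + (y - Pi.single (g v) 1)))) / Fintype.card V) + K * (1 - ρ ^ j))) := by
        rw [← Finset.mul_sum, Finset.sum_sub_distrib, ← Finset.mul_sum, Finset.sum_add_distrib,
          ← Finset.mul_sum]
        simp only [Finset.sum_const, Finset.card_univ, nsmul_eq_mul]
        field_simp
      calc c * (1 - Real.exp (-(θ * B)) * (ρ ^ (j + 1) *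
            Real.exp (θ * height (Δ (j + 1) M)) + K * (1 - ρ ^ (j + 1))))
          ≤ c * (1 - Real.exp (-(θ * B)) * (ρ ^ j * ((∑ v, Real.exp (θ * height
            (Δ (j + 1) M + (y - Pi.single (g v) 1)))) / Fintype.card V) +
              K * (1 - ρ ^ j))) := by
            gcongr c * (1 - Real.exp (-(θ * B)) * ?_)
            have := mul_le_mul_of_nonneg_left hdr (pow_nonneg hρ0 j)
            rw [pow_succ]
            linarith
        _ ≤ _ := by
            rw [← hsum]
            gcongr with v
            have := ih (M - Pi.single (g v) 1) (by
              have := sum_sub_single Finset.univ M (g v)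
              simp only [Finset.mem_univ, if_true] at this
              rw [this, hM]; push_cast; ring)
            rwa [hstep v] at this
  have hfin := key L N hN
  have hΔL : Δ L N = 0 := by
    funext e
    simp only [hΔ, hydef, Pi.zero_apply]
    field_simp
    ring
  have hh0 : height (0 : E → ℝ) = 1 := by simp [height]
  rw [hΔL, hh0, mul_one] at hfin
  refine le_trans (mul_le_mul_of_nonneg_left ?_ hc) hfin
  have hp0 := pow_nonneg hρ0 L
  have hp1 := pow_le_one₀ hρ0 hρ1.le (n := L)
  have : Real.exp (-(θ * B)) * (ρ ^ L * Real.exp θ + K * (1 - ρ ^ L)) ≤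
      Real.exp (-(θ * B)) * (Real.exp θ + K) := by
    gcongr
    · exact mul_le_of_le_one_left (Real.exp_pos _).le hp1
    · exact mul_le_of_le_one_right hK0 (by linarith)
  linarith

/-! ### Linked systems and positivity of the limit value -/

/-- No nontrivial set of choices can be separated from the rest. -/
def Linked : Prop := ∀ F : Finset E, F.Nonempty → F ≠ Finset.univ →
  ∃ v, (∃ e ∈ F, e ∈ S.inc v) ∧ ¬ S.inc v ⊆ F

variable {S}

theorem Linked.exists_mem_inc [Nontrivial E] (hS : S.Linked) (e : E) : ∃ v, e ∈ S.inc v := by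
  obtain ⟨f, hf⟩ := exists_ne e
  obtain ⟨v, ⟨e', he', hv⟩, -⟩ := hS {e} (by simp) (fun h => hf (by
    have := h ▸ Finset.mem_univ f
    simpa using this))
  exact ⟨v, by rwa [Finset.mem_singleton.1 he'] at hv⟩

/-- Answering every draw uniformly gives a distribution with margin. -/
theorem Linked.exists_hasMargin [Nonempty V] (hS : S.Linked) :
    ∃ (δ : ℝ) (y : E → ℝ), 0 < δ ∧ δ ≤ 1 ∧ (∀ e, 0 ≤ y e) ∧ ∑ e, y e = 1 ∧ S.HasMargin δ y := by
  have hk : (0 : ℝ) < Fintype.card V := by exact_mod_cast Fintype.card_pos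
  have hc : ∀ v, (0 : ℝ) < (S.inc v).card := fun v => by exact_mod_cast (S.nonempty v).card_pos
  set y : E → ℝ := fun e => (∑ v, if e ∈ S.inc v then 1 / ((S.inc v).card : ℝ) else 0) /
    Fintype.card V with hy
  have hyF : ∀ F : Finset E, ∑ e ∈ F, y e =
      (∑ v, ((F ∩ S.inc v).card : ℝ) / (S.inc v).card) / Fintype.card V := by
    intro F
    simp only [hy]
    rw [← Finset.sum_div, Finset.sum_comm]
    congr 1
    refine Finset.sum_congr rfl fun v _ => ?_
    rw [Finset.sum_ite_mem, Finset.sum_const, nsmul_eq_mul, mul_one_div]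
  have hstrict : ∀ F : Finset E, F.Nonempty → F ≠ Finset.univ →
      ((S.full F).card : ℝ) / Fintype.card V < ∑ e ∈ F, y e := by
    intro F hF hF'
    -- The point `w` is not full but sends some of its mass into `F`; this makes the inequality
    -- strict.
    obtain ⟨w, ⟨e, heF, hew⟩, hw⟩ := hS F hF hF'
    rw [hyF]
    gcongr
    have : ((S.full F).card : ℝ) = ∑ v, if v ∈ S.full F then (1 : ℝ) else 0 := by
      simp
    rw [this]
    refine Finset.sum_lt_sum (fun v _ => ?_) ⟨w, Finset.mem_univ _, ?_⟩
    · split_ifs with hv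
      · rw [Finset.inter_eq_right.2 (S.mem_full.1 hv), div_self (hc v).ne']
      · exact div_nonneg (Nat.cast_nonneg _) (hc v).le
    · rw [if_neg (fun h => hw (S.mem_full.1 h))]
      refine div_pos ?_ (hc w)
      exact_mod_cast Finset.card_pos.2 ⟨e, Finset.mem_inter.2 ⟨heF, hew⟩⟩
  have hev : ∀ᶠ δ : ℝ in 𝓝[>] 0, ∀ F : Finset E, F.Nonempty → F ≠ Finset.univ →
      ((S.full F).card : ℝ) / Fintype.card V + δ ≤ ∑ e ∈ F, y e := by
    rw [eventually_all]
    intro F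
    by_cases hF : F.Nonempty ∧ F ≠ Finset.univ
    · have := hstrict F hF.1 hF.2
      filter_upwards [Ioc_mem_nhdsGT (sub_pos.2 this)] with δ hδ _ _
      linarith [hδ.2]
    · exact Eventually.of_forall fun δ h1 h2 => absurd ⟨h1, h2⟩ hF
  obtain ⟨δ, hδ, hδ1⟩ := (hev.and (Ioc_mem_nhdsGT one_pos)).exists
  refine ⟨δ, y, hδ1.1, hδ1.2, fun e => ?_, ?_, hδ⟩
  · refine div_nonneg (Finset.sum_nonneg fun v _ => ?_) hk.le
    split_ifs
    · exact div_nonneg zero_le_one (hc v).le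
    · exact le_rfl
  · rw [hyF]
    simp only [Finset.univ_inter]
    rw [Finset.sum_congr rfl fun v _ => div_self (hc v).ne']
    simp

variable (S)

/-- The limit of the largest value among all states with a given number of rounds. -/
noncomputable def limitValue : ℝ := ⨅ t, ⨆ N, S.value t N

section Limit

variable [Nonempty V]

theorem bddAbove_value (t : ℕ) : BddAbove (Set.range (S.value t)) :=
  ⟨1, by rintro _ ⟨N, rfl⟩; exact S.value_le_one t N⟩

theorem bddBelow_iSup_value : BddBelow (Set.range fun t => ⨆ N, S.value t N) :=
  ⟨0, by rintro _ ⟨t, rfl⟩; exact Real.iSup_nonneg fun N => S.value_nonneg t N⟩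

/-- Each value is an average of values with one round less, so the suprema are nonincreasing and one
horizon close to the infimum settles all later ones. -/
theorem eventually_value_le {ε : ℝ} (hε : 0 < ε) :
    ∀ᶠ t in atTop, ∀ N, S.value t N ≤ S.limitValue + ε := by
  obtain ⟨t₀, ht₀⟩ := exists_lt_of_ciInf_lt
    (show ⨅ t, ⨆ N, S.value t N < S.limitValue + ε by rw [limitValue]; linarith)
  filter_upwards [eventually_ge_atTop t₀] with t ht N
  refine S.value_le_of_le ∅ 0 ht (fun N _ => ?_) N (by simp)
  exact (le_ciSup (S.bddAbove_value t₀) N).trans ht₀.le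

theorem exists_le_value {ε : ℝ} (hε : 0 < ε) (t : ℕ) :
    ∃ N, S.limitValue - ε ≤ S.value t N := by
  have h1 : S.limitValue ≤ ⨆ N, S.value t N := ciInf_le S.bddBelow_iSup_value t
  obtain ⟨N, hN⟩ := exists_lt_of_lt_ciSup (show S.limitValue - ε < ⨆ N, S.value t N by linarith)
  exact ⟨N, hN.le⟩

theorem limitValue_le_one : S.limitValue ≤ 1 :=
  (ciInf_le S.bddBelow_iSup_value 0).trans (ciSup_le fun N => S.value_le_one 0 N)

/-- Steer to the constant state `B`: every state within the steering radius is nonnegative, hence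
won with probability at least `c`. The radius, and with it `c`, is independent of the horizon. -/
theorem limitValue_pos [Nontrivial E] (hS : S.Linked) : 0 < S.limitValue := by
  obtain ⟨δ, y, hδ, hδ1, hy0, hy1, hmar⟩ := hS.exists_hasMargin
  obtain ⟨B, hB⟩ := S.exists_steering_radius (half_pos hδ) (by linarith)
    (show (0 : ℝ) < 1 / 2 by norm_num)
  have hk : (0 : ℝ) < Fintype.card V := by exact_mod_cast Fintype.card_pos
  set t₀ : ℕ := Fintype.card E * B with ht₀
  set c : ℝ := (1 / Fintype.card V) ^ t₀ with hc
  have hc0 : 0 < c := by positivity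
  obtain ⟨e₀⟩ : Nonempty E := inferInstance
  refine lt_of_lt_of_le (show 0 < c * (1 - 1 / 2) by linarith) (le_ciInf fun t => ?_)
  obtain ⟨L, hL⟩ := exists_nat_ge (max (t : ℝ) (max 1 (Fintype.card E / (δ / 2))))
  have hLt : t ≤ L := by exact_mod_cast (le_max_left _ _).trans hL
  have hL1 : (1 : ℝ) ≤ L := ((le_max_left _ _).trans (le_max_right _ _)).trans hL
  have hLm : (Fintype.card E : ℝ) ≤ L * (δ / 2) := by
    rw [← div_le_iff₀ (by positivity)]
    exact ((le_max_right _ _).trans (le_max_right _ _)).trans hL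
  -- Integer rounding of `L * y` with total exactly `L`, the remainder being put on `e₀`. It loses
  -- at most one unit per place, which half of the margin covers.
  set Y : E → ℤ := fun e => ⌊L * y e⌋ + if e = e₀ then (L - ∑ f, ⌊L * y f⌋) else 0 with hY
  have hY1 : ∑ e, Y e = L := by
    simp only [hY]
    rw [Finset.sum_add_distrib, Finset.sum_ite_eq' Finset.univ e₀]
    simp
  have hrest : (0 : ℤ) ≤ L - ∑ f, ⌊L * y f⌋ := by
    have : ((∑ f, ⌊L * y f⌋ : ℤ) : ℝ) ≤ L := by
      push_cast
      calc ∑ f, (⌊L * y f⌋ : ℝ) ≤ ∑ f, L * y f := Finset.sum_le_sum fun f _ => Int.floor_le _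
        _ = L := by rw [← Finset.mul_sum, hy1, mul_one]
    have : (∑ f, ⌊L * y f⌋ : ℤ) ≤ (L : ℤ) := by exact_mod_cast this
    omega
  have hYge : ∀ e, L * y e - 1 ≤ (Y e : ℝ) := by
    intro e
    have h1 : (⌊L * y e⌋ : ℤ) ≤ Y e := by
      simp only [hY]; split_ifs <;> omega
    have h2 : ((⌊L * y e⌋ : ℤ) : ℝ) ≤ Y e := by exact_mod_cast h1
    linarith [Int.sub_one_lt_floor (L * y e)]
  have h1 := hB t₀ L (fun e => B + Y e) (fun _ => B) c (by exact_mod_cast hL1) hc0.le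
    (by rw [Finset.sum_add_distrib, hY1]; simp [ht₀]) (by simp [ht₀]) ?_ ?_
  · have hmon : t ≤ t₀ + L := by omega
    exact h1.trans (S.value_le_of_le ∅ 0 hmon
      (fun N _ => le_ciSup (S.bddAbove_value t) N) _ (by simp))
  · intro F hF hF'
    have h2 := hmar F hF hF'
    rw [← Finset.sum_div, le_div_iff₀ (by linarith)]
    have h3 : L * ∑ e ∈ F, y e - Fintype.card E ≤
        ∑ e ∈ F, (((B + Y e : ℤ) : ℝ) - ((B : ℤ) : ℝ)) := by
      calc L * ∑ e ∈ F, y e - Fintype.card E ≤ ∑ e ∈ F, (L * y e - 1) := by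
            rw [Finset.sum_sub_distrib, ← Finset.mul_sum, Finset.sum_const, nsmul_one]
            have : (F.card : ℝ) ≤ Fintype.card E := by exact_mod_cast Finset.card_le_univ F
            linarith
        _ ≤ _ := Finset.sum_le_sum fun e _ => by
            push_cast
            linarith [hYge e]
    have h4 := mul_le_mul_of_nonneg_left h2 (by linarith : (0 : ℝ) ≤ L)
    linarith
  · intro N' hN' hnear
    refine S.pow_le_value hS.exists_mem_inc t₀ N' (fun e => ?_) hN'
    have := (abs_le.1 (hnear e)).1
    omega

end Limit

/-! ### Thin sets and gaps -/

theorem sum_used_eq_countP (F : Finset E) (l : List (V × E)) :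
    ∑ e ∈ F, used l e = (l.countP fun p => p.2 ∈ F : ℕ) := by
  induction l with
  | nil => simp
  | cons p l ih =>
    rw [used_cons, List.countP_cons]
    simp only [Pi.add_apply, Finset.sum_add_distrib, ih]
    by_cases h : p.2 ∈ F <;> simp [Pi.single_apply, h, add_comm]

theorem countP_le_add {α : Type*} {p q q' : α → Bool} (l : List α)
    (h : ∀ x ∈ l, p x → q x ∨ q' x) : l.countP p ≤ l.countP q + l.countP q' := by
  induction l with
  | nil => simp
  | cons x l ih =>
    have h1 := ih fun y hy => h y (List.mem_cons_of_mem _ hy)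
    have h2 := h x List.mem_cons_self
    simp only [List.countP_cons]
    by_cases hp : p x
    · rcases h2 hp with h3 | h3 <;> simp only [hp, h3, if_true] <;> omega
    · simp only [hp]
      simp only [Bool.false_eq_true, if_false]
      omega

theorem sub_used_le (N : E → ℤ) (l : List (V × E)) (e : E) : (N - used l) e ≤ N e := by
  have := used_nonneg l e
  simp only [Pi.sub_apply]
  omega

/-- Values close to the limit value occur at states that are bounded on `Z`. -/
def IsThin (Z : Finset E) : Prop :=
  ∀ η : ℝ, 0 < η → ∃ r : ℤ, ∀ t, ∃ N : E → ℤ, (∀ z ∈ Z, N z ≤ r) ∧ S.limitValue - η ≤ S.value t N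

/-- States that are bounded on `Z` and at some place outside `Z` have values below the limit value
by at least `γ`, eventually. -/
def HasGap (Z : Finset E) (γ : ℝ) : Prop :=
  ∀ f, f ∉ Z → ∀ r : ℤ, ∀ᶠ t in atTop, ∀ N : E → ℤ, (∀ z ∈ Z, N z ≤ r) → N f ≤ r →
    S.value t N ≤ S.limitValue - γ

/-- Take `Z` maximal among the thin sets, of which `∅` is one. Non-thinness of `insert f Z` yields a
deficit at some horizon for each bound `r`, it persists for longer horizons, and finitely many `f`
share one `γ`. -/
theorem exists_isThin_hasGap [Nonempty V] : ∃ (Z : Finset E) (γ : ℝ), 0 < γ ∧ S.IsThin Z ∧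
    S.HasGap Z γ := by
  classical
  have hne : (Finset.univ.filter fun Z => S.IsThin Z).Nonempty := by
    refine ⟨∅, ?_⟩
    simp only [Finset.mem_filter, Finset.mem_univ, true_and]
    intro η hη
    refine ⟨0, fun t => ?_⟩
    obtain ⟨N, hN⟩ := S.exists_le_value hη t
    exact ⟨N, by simp, hN⟩
  obtain ⟨Z, hZ⟩ := Finset.exists_maximal hne
  have hZt : S.IsThin Z := by simpa using hZ.prop
  have hev : ∀ f, ∀ᶠ γ : ℝ in 𝓝[>] 0, f ∉ Z → ∀ r : ℤ, ∀ᶠ t in atTop, ∀ N : E → ℤ,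
      (∀ z ∈ Z, N z ≤ r) → N f ≤ r → S.value t N ≤ S.limitValue - γ := by
    intro f
    by_cases hf : f ∈ Z
    · exact Eventually.of_forall fun γ h => absurd hf h
    have hnot : ¬ S.IsThin (insert f Z) := by
      intro h
      have := hZ.le_of_ge (y := insert f Z) (by simpa using h) (Finset.subset_insert f Z)
      exact hf (this (Finset.mem_insert_self f Z))
    unfold IsThin at hnot
    push Not at hnot
    obtain ⟨η, hη, h⟩ := hnot
    filter_upwards [Ioc_mem_nhdsGT hη] with γ hγ _ r
    obtain ⟨t₀, ht₀⟩ := h r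
    filter_upwards [eventually_ge_atTop t₀] with t ht N hN hNf
    refine (S.value_le_of_le (insert f Z) r ht (fun N hN => (ht₀ N hN).le) N ?_).trans ?_
    · intro z hz
      rcases Finset.mem_insert.1 hz with rfl | hz
      · exact hNf
      · exact hN z hz
    · linarith [hγ.2]
  obtain ⟨γ, hγ, hγ0⟩ := ((eventually_all.2 hev).and self_mem_nhdsWithin).exists
  exact ⟨Z, γ, hγ0, hZt, hγ⟩

/-- A positive value forces the coordinates to sum to `t`, which is impossible for large `t` if all
of them are bounded. -/
theorem IsThin.ne_univ [Nonempty V] [Nontrivial E] {S : ChoiceSystem V E} (hS : S.Linked)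
    {Z : Finset E} (hZ : S.IsThin Z) : ∃ h, h ∉ Z := by
  by_contra! hall
  have hM := S.limitValue_pos hS
  obtain ⟨r, hr⟩ := hZ (S.limitValue / 2) (by linarith)
  obtain ⟨N, hN, hv⟩ := hr (Fintype.card E * r.toNat + 1)
  have h1 := (S.nonneg_and_sum_of_value_ne_zero _ N (by linarith)).2
  have h2 : ∑ e, N e ≤ ∑ _e : E, (r.toNat : ℤ) := Finset.sum_le_sum fun e _ =>
    (hN e (hall e)).trans (Int.self_le_toNat r)
  rw [h1] at h2
  simp at h2

/-! ### Contraction of the gains -/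

/-- The advantage of a state over the state with one unit moved from `f` to `e`, where the former
is counted with the weight `1 + A`. -/
noncomputable def gain (A : ℝ) (e f : E) (t : ℕ) (N : E → ℤ) : ℝ :=
  (1 + A) * S.value t N - S.value t (N + Pi.single e 1 - Pi.single f 1)

theorem gain_self (A : ℝ) (e : E) (t : ℕ) (N : E → ℤ) : S.gain A e e t N = A * S.value t N := by
  rw [gain, add_sub_cancel_right]; ring

theorem gain_le (A : ℝ) (e f : E) (t : ℕ) (N : E → ℤ) :
    S.gain A e f t N ≤ (1 + A) * S.value t N := by
  rw [gain]
  linarith [S.value_nonneg t (N + Pi.single e 1 - Pi.single f 1)]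

/-- The first term of the gain is a martingale under optimal play, and the copying player bounds the
subtracted value from below. -/
theorem gain_le_run (A : ℝ) (e f : E) (w : V) (f' : E) (s L : ℕ) (N : E → ℤ) :
    S.gain A e f (s + L) N ≤ S.run s L (fun l => S.gain A e
      (if f' ∈ S.inc w ∧ (w, f) ∈ l then f' else f) s (N - used l)) N := by
  have h1 := S.run_shift_le_value s L N e f w f'
  have h2 : S.run s L (fun l => S.gain A e
      (if f' ∈ S.inc w ∧ (w, f) ∈ l then f' else f) s (N - used l)) N =
      (1 + A) * S.value (s + L) N + (-1) * S.run s L (fun l => S.value s (N - used l +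
        Pi.single e 1 - Pi.single (if f' ∈ S.inc w ∧ (w, f) ∈ l then f' else f) 1)) N := by
    rw [value_add_eq_run, ← run_mul, ← run_mul, ← run_add]
    congr 1
    funext l
    rw [gain]
    ring
  rw [h2, gain]
  linarith

/-- If the missing unit cannot move from `H` to a new place, then the choices from the set
`(H ∪ Z).erase e` are, up to few exceptions, the forced ones. -/
theorem forced_of_no_move {Z H : Finset E} {e : E} (heH : e ∉ H) {l : List (V × E)}
    (hl : ∀ p ∈ l, p.2 ∈ S.inc p.1)
    (hno : ∀ h ∈ H, ∀ w, (w, h) ∈ l → ∀ f' ∈ S.inc w, f' ∈ insert e Zᶜ → f' ∈ H)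
    {r : ℤ} (hr : ∀ z ∈ Z, used l z ≤ r) :
    (∀ h ∈ H, ∀ w, (w, h) ∈ l → w ∈ S.full ((H ∪ Z).erase e)) ∧
    (l.countP (fun p => p.1 ∈ S.full ((H ∪ Z).erase e)) : ℤ) ≤
      ∑ f ∈ (H ∪ Z).erase e, used l f ∧
    ∑ f ∈ (H ∪ Z).erase e, used l f ≤
      (l.countP (fun p => p.1 ∈ S.full ((H ∪ Z).erase e)) : ℤ) + Fintype.card E * r.toNat := by
  have h1 : ∀ h ∈ H, ∀ w, (w, h) ∈ l → w ∈ S.full ((H ∪ Z).erase e) := by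
    intro h hh w hw
    rw [mem_full]
    intro f' hf'
    by_cases hI : f' ∈ insert e Zᶜ
    · have := hno h hh w hw f' hf' hI
      exact Finset.mem_erase.2 ⟨fun hfe => heH (hfe ▸ this), Finset.mem_union_left _ this⟩
    · simp only [Finset.mem_insert, Finset.mem_compl, not_or, not_not] at hI
      exact Finset.mem_erase.2 ⟨hI.1, Finset.mem_union_right _ hI.2⟩
  refine ⟨h1, ?_, ?_⟩
  · rw [sum_used_eq_countP]
    norm_cast
    refine List.countP_mono_left fun p hp hpD => ?_
    simp only [decide_eq_true_eq, mem_full] at hpD ⊢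
    exact hpD (hl p hp)
  · have h2 : (∑ z ∈ Z, used l z : ℤ) ≤ Fintype.card E * r.toNat := by
      calc (∑ z ∈ Z, used l z : ℤ) ≤ ∑ _z ∈ Z, (r.toNat : ℤ) :=
            Finset.sum_le_sum fun z hz => (hr z hz).trans (Int.self_le_toNat r)
        _ = Z.card * r.toNat := by simp
        _ ≤ _ := by
          gcongr
          exact Finset.card_le_univ Z
    rw [sum_used_eq_countP] at h2 ⊢
    -- A choice from `H` comes from a forced draw, and choices from `Z` are few.
    have h3 : l.countP (fun p => p.2 ∈ (H ∪ Z).erase e) ≤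
        l.countP (fun p => p.1 ∈ S.full ((H ∪ Z).erase e)) + l.countP (fun p => p.2 ∈ Z) := by
      refine countP_le_add l fun p hp hpH => ?_
      simp only [decide_eq_true_eq] at hpH ⊢
      rcases Finset.mem_union.1 (Finset.mem_of_mem_erase hpH) with h | h
      · exact Or.inl (h1 p.2 h p.1 hp)
      · exact Or.inr h
    have h4 : (l.countP (fun p => p.2 ∈ (H ∪ Z).erase e) : ℤ) ≤
        l.countP (fun p => p.1 ∈ S.full ((H ∪ Z).erase e)) + l.countP (fun p => p.2 ∈ Z) := by
      exact_mod_cast h3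
    linarith

section Step

variable {S} [Nonempty V] {Z : Finset E} {γ A : ℝ}

/-- One long block of optimal play improves a bound for the gains on `H`, if such bounds are known
for the larger sets. -/
theorem HasGap.gain_step (hcov : ∀ e, ∃ v, e ∈ S.inc v) (hgap : S.HasGap Z γ) (hA0 : 0 ≤ A)
    (hA : (1 + A) * (S.limitValue - γ) ≤ A * S.limitValue) (hM : 0 ≤ S.limitValue)
    {r : ℤ} {e : E} {H : Finset E} (hH : H.Nonempty) (heH : e ∉ H) (hHZ : ∀ h ∈ H, h ∉ Z)
    {q : ℝ} (hq0 : 0 ≤ q) (hq1 : q ≤ 1) {c : ℝ} (hc : A * S.limitValue ≤ c)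
    (hP : ∀ᶠ t in atTop, ∀ N : E → ℤ, (∀ z ∈ Z, N z ≤ r) → ∀ f ∈ insert e Zᶜ,
      S.gain A e f t N ≤ c)
    (hext : ∀ f' ∈ insert e Zᶜ, f' ∉ H → ∀ β, 0 < β → ∀ᶠ t in atTop, ∀ N : E → ℤ,
      (∀ z ∈ Z, N z ≤ r) → ∃ f ∈ insert f' H,
        S.gain A e f t N ≤ c - q * (c - A * S.limitValue) + β)
    {β : ℝ} (hβ : 0 < β) :
    ∀ᶠ t in atTop, ∀ N : E → ℤ, (∀ z ∈ Z, N z ≤ r) → ∃ f ∈ H, S.gain A e f t N ≤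
      c - q / (H ×ˢ (Finset.univ : Finset V) ×ˢ insert e Zᶜ).card * (c - A * S.limitValue) +
        β := by
  set I : Finset E := insert e Zᶜ with hI
  have hHI : ∀ h ∈ H, h ∈ I := fun h hh => by
    rw [hI]; exact Finset.mem_insert_of_mem (Finset.mem_compl.2 (hHZ h hh))
  -- A triple `(h, w, f')` encodes one copying player: deficit at `h`, to be passed to `f'` when `w`
  -- is answered by `h`. Averaging over all triples avoids guessing which deviation will be
  -- possible.
  set T := H ×ˢ (Finset.univ : Finset V) ×ˢ I with hT
  obtain ⟨h₀, hh₀⟩ := hH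
  obtain ⟨v₀⟩ : Nonempty V := inferInstance
  have hK1 : (1 : ℝ) ≤ T.card := by
    have : T.Nonempty := ⟨(h₀, v₀, e), by simp [hT, hI, hh₀]⟩
    exact_mod_cast this.card_pos
  set K : ℝ := (T.card : ℝ) with hK
  set x : ℝ := c - A * S.limitValue with hx
  have hx0 : 0 ≤ x := sub_nonneg.2 hc
  have hAM : 0 ≤ A * S.limitValue := mul_nonneg hA0 hM
  have hqx : q * x ≤ x := mul_le_of_le_one_left hx0 hq1
  -- the level `s` at the end of the block
  have hext' : ∀ᶠ t in atTop, ∀ f', f' ∈ I → f' ∉ H → ∀ N : E → ℤ, (∀ z ∈ Z, N z ≤ r) →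
      ∃ f ∈ insert f' H, S.gain A e f t N ≤ c - q * x + β / 2 := by
    rw [eventually_all]
    intro f'
    by_cases h : f' ∈ I ∧ f' ∉ H
    · exact (hext f' h.1 h.2 (β / 2) (half_pos hβ)).mono fun t ht _ _ => ht
    · exact Eventually.of_forall fun t h1 h2 => absurd ⟨h1, h2⟩ h
  obtain ⟨s, hsP, hsext⟩ := (hP.and hext').exists
  set D := S.full ((H ∪ Z).erase e) with hD
  have hDu : D ≠ Finset.univ := by
    intro h
    obtain ⟨v, hv⟩ := hcov e
    have h1 : v ∈ D := h ▸ Finset.mem_univ v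
    have h2 := (S.mem_full.1 h1) hv
    exact (Finset.notMem_erase e _) h2
  set R : ℕ := Fintype.card E * r.toNat with hR
  set β' : ℝ := β / (4 * (x + 1)) with hβ'
  have hβ'0 : 0 < β' := by positivity
  have hwin : ∀ᶠ L in atTop, D.Nonempty → ∀ (N : E → ℤ) (a : ℤ),
      S.run s L (fun l => if a ≤ (l.countP (fun p => p.1 ∈ D) : ℤ) ∧
        (l.countP (fun p => p.1 ∈ D) : ℤ) ≤ a + (s + R : ℕ) then 1 else 0) N ≤ β' := by
    by_cases hDne : D.Nonempty
    · exact (S.eventually_run_window_le hDne hDu (s + R) hβ'0).mono fun L hL _ N a => hL s N a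
    · exact Eventually.of_forall fun L h => absurd h hDne
  have hthin : ∀ᶠ L in atTop, ∀ f, f ∉ Z → ∀ N : E → ℤ, (∀ z ∈ Z, N z ≤ r) → N f ≤ s →
      S.value (s + L) N ≤ S.limitValue - γ := by
    rw [eventually_all]
    intro f
    by_cases hf : f ∈ Z
    · exact Eventually.of_forall fun L h => absurd hf h
    have h1 := (tendsto_add_atTop_nat s).eventually (hgap f hf (max r s))
    filter_upwards [h1] with L hL _ N hN hNf
    rw [add_comm]
    exact hL N (fun z hz => (hN z hz).trans (le_max_left _ _)) (hNf.trans (le_max_right _ _))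
  rw [← map_add_atTop_eq_nat s, eventually_map]
  filter_upwards [hwin, hthin] with L hwinL hthinL N hN
  rw [add_comm L s]
  by_contra! hcon
  have hX : A * S.limitValue ≤ c - q / K * x := by
    have : q / K ≤ 1 := (div_le_one (by linarith)).2 (hq1.trans hK1)
    have := mul_le_of_le_one_left hx0 this
    linarith
  -- Otherwise the gap together with `hA` bounds the gain at `h₀` by `A * limitValue`, contrary to
  -- `hcon`. Hence every place outside `Z` must be used during the block if the play can still win.
  have hbig : ∀ f, f ∉ Z → (s : ℤ) < N f := by
    intro f hf
    by_contra hle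
    have h1 := hthinL f hf N hN (not_lt.1 hle)
    have h2 := hcon h₀ hh₀
    have h3 := S.gain_le A e h₀ (s + L) N
    have h4 := mul_le_mul_of_nonneg_left h1 (by linarith : 0 ≤ 1 + A)
    linarith
  let out : E × V × E → List (V × E) → E := fun p l =>
    if p.2.2 ∈ S.inc p.2.1 ∧ (p.2.1, p.1) ∈ l then p.2.2 else p.1
  have hout : ∀ p ∈ T, ∀ l, out p l ∈ I := by
    intro p hp l
    simp only [hT, Finset.mem_product] at hp
    simp only [out]
    split_ifs
    · exact hp.2.2
    · exact hHI _ hp.1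
  -- Without a possible move the forced draws number the initial total on the set, up to at most `s`
  -- units left over and `R` uses of `Z`.
  set a : ℤ := ∑ f ∈ (H ∪ Z).erase e, N f - s - R with ha
  obtain ⟨ind, hind0, hindle, hind1⟩ : ∃ ind : List (V × E) → ℝ, (∀ l, 0 ≤ ind l) ∧
      S.run s L ind N ≤ β' ∧ ∀ l, D.Nonempty → a ≤ (l.countP (fun p => p.1 ∈ D) : ℤ) →
        (l.countP (fun p => p.1 ∈ D) : ℤ) ≤ a + (s + R : ℕ) → 1 ≤ ind l := by
    by_cases hDne : D.Nonempty
    · refine ⟨_, fun l => ?_, hwinL hDne N a, fun l _ h1 h2 => ?_⟩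
      · split_ifs <;> norm_num
      · rw [if_pos ⟨h1, h2⟩]
    · refine ⟨fun _ => 0, fun l => le_rfl, ?_, fun l h => absurd h hDne⟩
      rw [run_const]; exact hβ'0.le
  have hpath : ∀ l : List (V × E), (∀ p ∈ l, p.2 ∈ S.inc p.1) →
      ∑ p ∈ T, S.gain A e (out p l) s (N - used l) ≤
        (K * c - q * x + K * (β / 2)) + q * x * ind l := by
    intro l hl
    have hindq : 0 ≤ q * x * ind l := mul_nonneg (mul_nonneg hq0 hx0) (hind0 l)
    have hKβ : β / 2 ≤ K * (β / 2) := le_mul_of_one_le_left (half_pos hβ).le hK1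
    -- Lost positions have nonpositive gains, so all terms together already lie below the target.
    by_cases hv : S.value s (N - used l) = 0
    · have h1 : ∑ p ∈ T, S.gain A e (out p l) s (N - used l) ≤ ∑ _p ∈ T, A * S.limitValue :=
        Finset.sum_le_sum fun p _ => by
          have := S.gain_le A e (out p l) s (N - used l)
          rw [hv, mul_zero] at this
          linarith
      rw [Finset.sum_const, nsmul_eq_mul, ← hK] at h1
      have h2 : x ≤ K * x := le_mul_of_one_le_left hx0 hK1
      have h3 : K * x = K * c - K * (A * S.limitValue) := by rw [hx]; ring
      linarith
    obtain ⟨hnn, hsum⟩ := S.nonneg_and_sum_of_value_ne_zero s _ hv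
    have hcl : ∀ z ∈ Z, (N - used l) z ≤ r := fun z hz => (sub_used_le N l z).trans (hN z hz)
    have hle : ∀ p ∈ T, S.gain A e (out p l) s (N - used l) ≤ c := fun p hp =>
      hsP _ hcl _ (hout p hp l)
    -- If the deficit can leave `H` for `f'`, the bound for `insert f' H` applies at a place reached
    -- by one of the triples; that term alone saves `q * x`.
    by_cases hgrow : ∃ h ∈ H, ∃ w, (w, h) ∈ l ∧ ∃ f' ∈ S.inc w, f' ∈ I ∧ f' ∉ H
    · obtain ⟨h, hh, w, hwl, f', hf'w, hf'I, hf'H⟩ := hgrow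
      obtain ⟨g, hg, hgain⟩ := hsext f' hf'I hf'H _ hcl
      obtain ⟨p, hpT, hpg⟩ : ∃ p ∈ T, out p l = g := by
        rcases Finset.mem_insert.1 hg with rfl | hgH
        · refine ⟨(h, w, g), by simp [hT, hh, hf'I], ?_⟩
          simp only [out]
          rw [if_pos ⟨hf'w, hwl⟩]
        · exact ⟨(g, w, g), by simp [hT, hgH, hHI g hgH], by simp [out]⟩
      rw [← Finset.add_sum_erase T _ hpT, hpg]
      have h1 : ∑ p ∈ T.erase p, S.gain A e (out p l) s (N - used l) ≤ ∑ _p ∈ T.erase p, c :=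
        Finset.sum_le_sum fun p hp => hle p (Finset.mem_of_mem_erase hp)
      rw [Finset.sum_const, Finset.card_erase_of_mem hpT, nsmul_eq_mul,
        Nat.cast_sub (Finset.card_pos.2 ⟨p, hpT⟩), ← hK] at h1
      push_cast at h1
      linarith
    · push Not at hgrow
      obtain ⟨h1, h2, h3⟩ := S.forced_of_no_move (Z := Z) heH hl
        (fun h hh w hw f' hf' hfI => hgrow h hh w hw f' hf' hfI) (r := r) (fun z hz => by
          have h4 := hnn z
          have h5 := hN z hz
          simp only [Pi.sub_apply] at h4
          omega)
      have hle' : ∀ f, (N - used l) f ≤ s := fun f => by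
        rw [← hsum]
        exact Finset.single_le_sum (f := fun f => (N - used l) f) (fun f _ => hnn f)
          (Finset.mem_univ f)
      have hDne : D.Nonempty := by
        have h4 := hbig h₀ (hHZ h₀ hh₀)
        have h5 := hle' h₀
        simp only [Pi.sub_apply] at h5
        have h6 : 0 < (l.map Prod.snd).count h₀ := by
          have : 0 < used l h₀ := by omega
          simpa [used] using this
        obtain ⟨p, hp, hp2⟩ := List.mem_map.1 (List.count_pos_iff.1 h6)
        exact ⟨p.1, h1 h₀ hh₀ p.1 (by rw [← hp2]; exact hp)⟩
      have hs1 : 0 ≤ ∑ f ∈ (H ∪ Z).erase e, (N - used l) f := Finset.sum_nonneg fun f _ => hnn f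
      have hs2 : ∑ f ∈ (H ∪ Z).erase e, (N - used l) f ≤ s := by
        rw [← hsum]
        exact Finset.sum_le_sum_of_subset_of_nonneg (Finset.subset_univ _) fun f _ _ => hnn f
      simp only [Pi.sub_apply, Finset.sum_sub_distrib] at hs1 hs2
      rw [← hD] at h2 h3
      have h7 := hind1 l hDne (by rw [ha, hR]; push_cast; linarith)
        (by rw [ha, hR]; push_cast; linarith)
      have h8 : q * x ≤ q * x * ind l := le_mul_of_one_le_right (mul_nonneg hq0 hx0) h7
      have h9 : ∑ p ∈ T, S.gain A e (out p l) s (N - used l) ≤ ∑ _p ∈ T, c :=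
        Finset.sum_le_sum hle
      rw [Finset.sum_const, nsmul_eq_mul, ← hK] at h9
      linarith
  -- A saving of `q * x` in one of `K` terms is `q / K * x` on average, which contradicts `hcon`
  -- once the rare window event is discounted.
  have hlow : K * (c - q / K * x + β) ≤ ∑ p ∈ T, S.gain A e p.1 (s + L) N := by
    rw [hK, ← nsmul_eq_mul, ← Finset.sum_const]
    refine Finset.sum_le_sum fun p hp => ?_
    exact (hcon p.1 (Finset.mem_product.1 hp).1).le
  have hup : ∑ p ∈ T, S.gain A e p.1 (s + L) N ≤
      (K * c - q * x + K * (β / 2)) + q * x * S.run s L ind N := by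
    calc ∑ p ∈ T, S.gain A e p.1 (s + L) N
        ≤ ∑ p ∈ T, S.run s L (fun l => S.gain A e (out p l) s (N - used l)) N :=
          Finset.sum_le_sum fun p _ => S.gain_le_run A e p.1 p.2.1 p.2.2 s L N
      _ = S.run s L (fun l => ∑ p ∈ T, S.gain A e (out p l) s (N - used l)) N := by
          rw [run_sum]
      _ ≤ S.run s L (fun l => (K * c - q * x + K * (β / 2)) + q * x * ind l) N :=
          S.run_mono s L N hpath
      _ = _ := by rw [run_add, run_const, run_mul]
  have h1 : q * x * S.run s L ind N ≤ β / 4 := by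
    calc q * x * S.run s L ind N ≤ q * x * β' := by gcongr
      _ ≤ (x + 1) * β' := by gcongr; linarith
      _ = β / 4 := by rw [hβ']; field_simp
  have h2 : K * (c - q / K * x + β) = K * c - q * x + K * β := by
    field_simp
  have h3 : β ≤ K * β := le_mul_of_one_le_left hβ.le hK1
  linarith

/-- The gains on `H` cannot all be close to `c`. Induction on the part of `insert e Zᶜ` outside `H`:
if `e ∈ H` the deficit is cancelled and `gain_self` applies; otherwise `gain_step` uses the sets
with one more place. Asking for all small `q` lets finitely many such sets share one. -/
theorem HasGap.eventually_exists_gain_le (hcov : ∀ e, ∃ v, e ∈ S.inc v) (hgap : S.HasGap Z γ)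
    (hA0 : 0 ≤ A) (hA : (1 + A) * (S.limitValue - γ) ≤ A * S.limitValue)
    (hM : 0 ≤ S.limitValue) (r : ℤ) (e : E) (H : Finset E) (hH : H.Nonempty)
    (hHI : H ⊆ insert e Zᶜ) :
    ∀ᶠ q : ℝ in 𝓝[>] 0, ∀ c, A * S.limitValue ≤ c →
      (∀ᶠ t in atTop, ∀ N : E → ℤ, (∀ z ∈ Z, N z ≤ r) → ∀ f ∈ insert e Zᶜ,
        S.gain A e f t N ≤ c) →
      ∀ β, 0 < β → ∀ᶠ t in atTop, ∀ N : E → ℤ, (∀ z ∈ Z, N z ≤ r) →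
        ∃ f ∈ H, S.gain A e f t N ≤ c - q * (c - A * S.limitValue) + β := by
  induction hn : (insert e Zᶜ \ H).card using Nat.strong_induction_on generalizing H with
  | _ n ih =>
    by_cases heH : e ∈ H
    · filter_upwards [Ioc_mem_nhdsGT one_pos] with q hq c hc _ β hβ
      filter_upwards [S.eventually_value_le (div_pos hβ (by linarith : 0 < A + 1))] with t ht N _
      refine ⟨e, heH, ?_⟩
      rw [gain_self]
      have h1 := mul_le_mul_of_nonneg_left (ht N) hA0
      have h2 : A * (β / (A + 1)) ≤ β := by
        rw [mul_div_assoc', div_le_iff₀ (by linarith)]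
        nlinarith
      have h3 := mul_le_mul_of_nonneg_right hq.2 (sub_nonneg.2 hc)
      linarith
    · have hHZ : ∀ h ∈ H, h ∉ Z := fun h hh => by
        rcases Finset.mem_insert.1 (hHI hh) with rfl | h1
        · exact absurd hh heH
        · exact Finset.mem_compl.1 h1
      have hev : ∀ᶠ q : ℝ in 𝓝[>] 0, ∀ f', f' ∈ insert e Zᶜ → f' ∉ H → ∀ c,
          A * S.limitValue ≤ c →
          (∀ᶠ t in atTop, ∀ N : E → ℤ, (∀ z ∈ Z, N z ≤ r) → ∀ f ∈ insert e Zᶜ,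
            S.gain A e f t N ≤ c) →
          ∀ β, 0 < β → ∀ᶠ t in atTop, ∀ N : E → ℤ, (∀ z ∈ Z, N z ≤ r) →
            ∃ f ∈ insert f' H, S.gain A e f t N ≤ c - q * (c - A * S.limitValue) + β := by
        rw [eventually_all]
        intro f'
        by_cases h : f' ∈ insert e Zᶜ ∧ f' ∉ H
        · have hcard : (insert e Zᶜ \ insert f' H).card < n := by
            rw [← hn]
            refine Finset.card_lt_card (Finset.ssubset_iff_of_subset
              (Finset.sdiff_subset_sdiff le_rfl (Finset.subset_insert _ _)) |>.2 ⟨f', ?_, ?_⟩)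
            · exact Finset.mem_sdiff.2 h
            · simp
          exact (ih _ hcard (insert f' H) (Finset.insert_nonempty _ _)
            (Finset.insert_subset h.1 hHI) rfl).mono fun q hq _ _ => hq
        · exact Eventually.of_forall fun q h1 h2 => absurd ⟨h1, h2⟩ h
      obtain ⟨q, hq, hq01⟩ := (hev.and (Ioc_mem_nhdsGT one_pos)).exists
      obtain ⟨h₀, hh₀⟩ := id hH
      obtain ⟨v₀⟩ : Nonempty V := inferInstance
      have hK1 : (0 : ℝ) < (H ×ˢ (Finset.univ : Finset V) ×ˢ insert e Zᶜ).card := by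
        exact_mod_cast Finset.card_pos.2 ⟨(h₀, v₀, e), by simp [hh₀]⟩
      filter_upwards [Ioc_mem_nhdsGT (div_pos hq01.1 hK1)] with q₁ hq₁ c hc hP β hβ
      filter_upwards [hgap.gain_step hcov hA0 hA hM hH heH hHZ hq01.1.le hq01.2 hc hP
        (fun f' h1 h2 => hq f' h1 h2 c hc hP) hβ] with t ht N hN
      obtain ⟨f, hf, h1⟩ := ht N hN
      refine ⟨f, hf, h1.trans ?_⟩
      have := mul_le_mul_of_nonneg_right hq₁.2 (sub_nonneg.2 hc)
      linarith

/-- States close to the limit value, with bounded values on `Z`, keep this property when a unit is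
moved from a place outside `Z`. -/
theorem HasGap.eventually_gain_le (hcov : ∀ e, ∃ v, e ∈ S.inc v) (hgap : S.HasGap Z γ)
    (hA0 : 0 ≤ A) (hA : (1 + A) * (S.limitValue - γ) ≤ A * S.limitValue)
    (hM : 0 ≤ S.limitValue) (r : ℤ) (e : E) {β : ℝ} (hβ : 0 < β) :
    ∀ᶠ t in atTop, ∀ N : E → ℤ, (∀ z ∈ Z, N z ≤ r) → ∀ f ∈ insert e Zᶜ,
      S.gain A e f t N ≤ A * S.limitValue + β := by
  have hev : ∀ᶠ q : ℝ in 𝓝[>] 0, ∀ f, f ∈ insert e Zᶜ → ∀ c, A * S.limitValue ≤ c →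
      (∀ᶠ t in atTop, ∀ N : E → ℤ, (∀ z ∈ Z, N z ≤ r) → ∀ f ∈ insert e Zᶜ,
        S.gain A e f t N ≤ c) →
      ∀ β, 0 < β → ∀ᶠ t in atTop, ∀ N : E → ℤ, (∀ z ∈ Z, N z ≤ r) →
        S.gain A e f t N ≤ c - q * (c - A * S.limitValue) + β := by
    rw [eventually_all]
    intro f
    by_cases hf : f ∈ insert e Zᶜ
    -- Singletons turn the existence statement into a bound at each single place, as the contraction
    -- needs.
    · filter_upwards [hgap.eventually_exists_gain_le hcov hA0 hA hM r e {f} (by simp)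
        (by simpa using hf)] with q hq _ c hc hP β hβ
      filter_upwards [hq c hc hP β hβ] with t ht N hN
      obtain ⟨f', hf', h⟩ := ht N hN
      rwa [Finset.mem_singleton.1 hf'] at h
    · exact Eventually.of_forall fun q h => absurd h hf
  obtain ⟨q, hq, hq01⟩ := (hev.and (Ioc_mem_nhdsGT one_pos)).exists
  refine of_contraction (P := fun c => ∀ᶠ t in atTop, ∀ N : E → ℤ, (∀ z ∈ Z, N z ≤ r) →
    ∀ f ∈ insert e Zᶜ, S.gain A e f t N ≤ c) (c₀ := 1 + A) hq01.1 hq01.2 ?_ ?_ ?_ hβ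
  · exact fun c c' hcc h => h.mono fun t ht N hN f hf => (ht N hN f hf).trans hcc
  · refine Eventually.of_forall fun t N _ f _ => (S.gain_le A e f t N).trans ?_
    exact mul_le_of_le_one_right (by linarith) (S.value_le_one t N)
  · intro c hc hP β hβ
    have : ∀ᶠ t in atTop, ∀ f, f ∈ insert e Zᶜ → ∀ N : E → ℤ, (∀ z ∈ Z, N z ≤ r) →
        S.gain A e f t N ≤ c - q * (c - A * S.limitValue) + β := by
      rw [eventually_all]
      intro f
      by_cases hf : f ∈ insert e Zᶜ
      · exact (hq f hf c hc hP β hβ).mono fun t ht _ => ht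
      · exact Eventually.of_forall fun t h => absurd h hf
    exact this.mono fun t ht N hN f hf => ht f hf N hN

end Step

end ChoiceSystem

/-! ### Balls of nearly optimal states and convergence -/

namespace ChoiceSystem

variable {V E : Type*} [Fintype V] [Fintype E] [DecidableEq V] [DecidableEq E]
  {S : ChoiceSystem V E} [Nonempty V]

/-- Carry out `D` one unit at a time. A unit is only taken where `D` is negative, hence outside `Z`,
so the gain bound applies; each transfer shortens the `ℓ¹` norm by two and raises the bound on `Z`
by at most one. -/
theorem HasGap.exists_shift_bound {Z : Finset E} {γ A : ℝ} (hcov : ∀ e, ∃ v, e ∈ S.inc v)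
    (hgap : S.HasGap Z γ) (hA0 : 0 ≤ A)
    (hA : (1 + A) * (S.limitValue - γ) ≤ A * S.limitValue) (hM : 0 ≤ S.limitValue) (n : ℕ)
    {ε : ℝ} (hε : 0 < ε) :
    ∃ η : ℝ, 0 < η ∧ ∀ r : ℤ, ∀ᶠ t in atTop, ∀ N : E → ℤ, (∀ z ∈ Z, N z ≤ r) →
      S.limitValue - η ≤ S.value t N → ∀ D : E → ℤ, ∑ e, D e = 0 → (∀ z ∈ Z, 0 ≤ D z) →
      ∑ e, |D e| ≤ 2 * n → S.limitValue - ε ≤ S.value t (N + D) := by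
  have hzero : ∀ D : E → ℤ, ∑ e, |D e| ≤ 0 → D = 0 := by
    intro D hD
    funext e
    have h1 := Finset.single_le_sum (f := fun e => |D e|) (fun e _ => abs_nonneg _)
      (Finset.mem_univ e)
    exact abs_eq_zero.1 (le_antisymm (h1.trans hD) (abs_nonneg _))
  induction n with
  | zero =>
    refine ⟨ε, hε, fun r => Eventually.of_forall fun t N _ hv D _ _ hD => ?_⟩
    rw [hzero D (by simpa using hD), add_zero]
    exact hv
  | succ n ih =>
    obtain ⟨η, hη, h⟩ := ih
    -- A transfer enlarges the deficit by the factor `1 + A` and adds the error `η / 2`, in total at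
    -- most `η`; the entry `ε` serves the case `D = 0`.
    refine ⟨min ε (η / (2 * (1 + A))), lt_min hε (by positivity), fun r => ?_⟩
    have hg : ∀ᶠ t in atTop, ∀ e, ∀ N : E → ℤ, (∀ z ∈ Z, N z ≤ r) → ∀ f ∈ insert e Zᶜ,
        S.gain A e f t N ≤ A * S.limitValue + η / 2 := by
      rw [eventually_all]
      exact fun e => hgap.eventually_gain_le hcov hA0 hA hM r e (half_pos hη)
    filter_upwards [h (r + 1), hg] with t ht hgt N hN hv D hD0 hDZ hD
    by_cases hDz : D = 0
    · rw [hDz, add_zero]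
      exact le_trans (by linarith [min_le_left ε (η / (2 * (1 + A)))]) hv
    have hpos : ∃ e, 0 < D e := by
      by_contra! hneg
      refine hDz (funext fun e => ?_)
      exact (Finset.sum_eq_zero_iff_of_nonpos fun e _ => hneg e).1 hD0 e (Finset.mem_univ e)
    have hneg : ∃ f, D f < 0 := by
      by_contra! hneg
      refine hDz (funext fun e => ?_)
      exact (Finset.sum_eq_zero_iff_of_nonneg fun e _ => hneg e).1 hD0 e (Finset.mem_univ e)
    obtain ⟨e, he⟩ := hpos
    obtain ⟨f, hf⟩ := hneg
    have hef : e ≠ f := by rintro rfl; omega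
    have hfZ : f ∉ Z := fun hfZ => by
      have := hDZ f hfZ
      omega
    have hgain := hgt e N hN f (Finset.mem_insert_of_mem (Finset.mem_compl.2 hfZ))
    rw [gain] at hgain
    have hv1 : S.limitValue - η ≤ S.value t (N + Pi.single e 1 - Pi.single f 1) := by
      have h1 : S.limitValue - η / (2 * (1 + A)) ≤ S.value t N :=
        le_trans (by linarith [min_le_right ε (η / (2 * (1 + A)))]) hv
      have h2 := mul_le_mul_of_nonneg_left h1 (by linarith : 0 ≤ 1 + A)
      have h3 : (1 + A) * (η / (2 * (1 + A))) = η / 2 := by field_simp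
      rw [mul_sub, h3] at h2
      linarith
    set D₁ : E → ℤ := D - Pi.single e 1 + Pi.single f 1 with hD₁
    have hND : N + D = N + Pi.single e 1 - Pi.single f 1 + D₁ := by rw [hD₁]; abel
    have hD₁e : D₁ e = D e - 1 := by simp [hD₁, Pi.single_eq_of_ne hef]
    have hD₁f : D₁ f = D f + 1 := by simp [hD₁, Pi.single_eq_of_ne hef.symm]
    have hD₁o : ∀ i, i ≠ e → i ≠ f → D₁ i = D i := fun i hi hi' => by
      simp [hD₁, Pi.single_eq_of_ne hi, Pi.single_eq_of_ne hi']
    rw [hND]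
    refine ht _ (fun z hz => ?_) hv1 D₁ ?_ (fun z hz => ?_) ?_
    · have hzf : z ≠ f := fun h => hfZ (h ▸ hz)
      have h1 := hN z hz
      have h2 : (Pi.single e 1 : E → ℤ) z ≤ 1 := by
        by_cases hze : z = e
        · subst hze; simp
        · simp [Pi.single_eq_of_ne hze]
      simp only [Pi.add_apply, Pi.sub_apply, Pi.single_eq_of_ne hzf]
      omega
    · simp [hD₁, Finset.sum_add_distrib, Finset.sum_sub_distrib, hD0]
    · have hzf : z ≠ f := fun h => hfZ (h ▸ hz)
      by_cases hze : z = e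
      · rw [hze, hD₁e]; omega
      · rw [hD₁o z hze hzf]; exact hDZ z hz
    · have h1 : ∑ i, |D₁ i| = ∑ i, (|D i| - (Pi.single e 1 : E → ℤ) i -
          (Pi.single f 1 : E → ℤ) i) := by
        refine Finset.sum_congr rfl fun i _ => ?_
        by_cases hie : i = e
        · subst hie
          rw [hD₁e, Pi.single_eq_same, Pi.single_eq_of_ne hef, abs_of_nonneg (by omega),
            abs_of_pos he]
          omega
        · by_cases hif : i = f
          · subst hif
            rw [hD₁f, Pi.single_eq_same, Pi.single_eq_of_ne hie, abs_of_nonpos (by omega),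
              abs_of_neg hf]
            omega
          · rw [hD₁o i hie hif, Pi.single_eq_of_ne hie, Pi.single_eq_of_ne hif]
            omega
      rw [h1, Finset.sum_sub_distrib, Finset.sum_sub_distrib]
      simp only [Finset.sum_pi_single', Finset.mem_univ, if_true]
      push_cast at hD
      omega

/-- With sufficiently many rounds there are large balls of states with values close to the limit
value. -/
theorem eventually_exists_ball [Nontrivial E] (hS : S.Linked) {ε : ℝ} (hε : 0 < ε) (B : ℕ) :
    ∀ᶠ t : ℕ in atTop, ∃ N₁ : E → ℤ, ∑ e, N₁ e = t ∧ ∀ N' : E → ℤ, ∑ e, N' e = t →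
      (∀ e, |N' e - N₁ e| ≤ B) → S.limitValue - ε ≤ S.value t N' := by
  have hM := S.limitValue_pos hS
  obtain ⟨Z, γ, hγ, hthin, hgap⟩ := S.exists_isThin_hasGap
  -- With `A * γ = limitValue` the left side of `hA1` is `A * limitValue - γ`.
  set A : ℝ := S.limitValue / γ with hA
  have hA0 : 0 ≤ A := by positivity
  have hA1 : (1 + A) * (S.limitValue - γ) ≤ A * S.limitValue := by
    have : A * γ = S.limitValue := div_mul_cancel₀ _ hγ.ne'
    nlinarith
  obtain ⟨h₀, hh₀⟩ := hthin.ne_univ hS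
  obtain ⟨η, hη, h⟩ := hgap.exists_shift_bound hS.exists_mem_inc hA0 hA1 hM.le
    (2 * (Fintype.card E * B)) hε
  obtain ⟨r, hr⟩ := hthin (min η (S.limitValue / 2)) (lt_min hη (by linarith))
  filter_upwards [h r] with t ht
  obtain ⟨N, hN, hv⟩ := hr t
  have hsum := (S.nonneg_and_sum_of_value_ne_zero t N (by
    linarith [min_le_right η (S.limitValue / 2)])).2
  -- Units can only be moved onto `Z`, never off it. The centre is therefore raised by `B` on `Z`,
  -- at the expense of `h₀ ∉ Z`, so that the whole ball lies above `N` on `Z`.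
  set P : E → ℤ := fun e => (if e ∈ Z then (B : ℤ) else 0) -
    if e = h₀ then (Z.card * B : ℤ) else 0 with hP
  have hPsum : ∑ e, P e = 0 := by
    simp only [hP]
    rw [Finset.sum_sub_distrib, Finset.sum_ite_eq', Finset.sum_ite_mem]
    simp
  refine ⟨N + P, by simp [Finset.sum_add_distrib, hsum, hPsum], fun N' hN' hnear => ?_⟩
  have hD := ht N hN (le_trans (by linarith [min_le_left η (S.limitValue / 2)]) hv) (N' - N)
    (by simp [Finset.sum_sub_distrib, hsum, hN']) (fun z hz => ?_) ?_
  · rwa [add_sub_cancel] at hD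
  · have h1 := (abs_le.1 (hnear z)).1
    have hzh : z ≠ h₀ := fun h => hh₀ (h ▸ hz)
    simp only [Pi.add_apply, hP, hz, hzh, if_true, if_false, sub_zero] at h1
    simp only [Pi.sub_apply]
    omega
  · have hle : ∀ e, |(N' - N) e| ≤ 2 * B + if e = h₀ then (Fintype.card E * B : ℤ) else 0 := by
      intro e
      have h1 := hnear e
      have h2 : (Z.card * B : ℤ) ≤ Fintype.card E * B := by
        gcongr
        exact Finset.card_le_univ Z
      have h3 : (0 : ℤ) ≤ Z.card * B := by positivity
      have h4 : N' e - N e = (N' e - (N + P) e) + P e := by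
        simp only [Pi.add_apply]; ring
      have h5 : |P e| ≤ B + if e = h₀ then (Fintype.card E * B : ℤ) else 0 := by
        simp only [hP]
        split_ifs <;> rw [abs_le] <;> constructor <;> linarith
      calc |(N' - N) e| = |(N' e - (N + P) e) + P e| := by rw [← h4]; rfl
        _ ≤ |N' e - (N + P) e| + |P e| := abs_add_le _ _
        _ ≤ _ := by linarith
    refine (Finset.sum_le_sum fun e _ => hle e).trans ?_
    rw [Finset.sum_add_distrib, Finset.sum_ite_eq']
    simp
    nlinarith [show (0 : ℤ) ≤ Fintype.card E * B by positivity]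

/-- The values of states in directions with margin converge to the limit value. -/
theorem HasMargin.eventually_value_near [Nontrivial E] (hS : S.Linked) {δ : ℝ} (hδ : 0 < δ)
    {x : E → ℝ} (hx : S.HasMargin δ x) (C : ℝ) {ε : ℝ} (hε : 0 < ε) :
    ∀ᶠ n : ℕ in atTop, ∀ N : E → ℤ, ∑ e, N e = n → (∀ e, |(N e : ℝ) - n * x e| ≤ C) →
      |S.value n N - S.limitValue| ≤ ε := by
  wlog hδ1 : δ ≤ 1 generalizing δ
  · exact this one_pos (fun F h1 h2 => le_trans (by linarith) (hx F h1 h2)) le_rfl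
  have hM := S.limitValue_pos hS
  have hM1 := S.limitValue_le_one
  set ε₁ : ℝ := min (ε / 2) (S.limitValue / 2) with hε₁
  have hε₁0 : 0 < ε₁ := lt_min (half_pos hε) (half_pos hM)
  have hε₁ε : ε₁ ≤ ε / 2 := min_le_left _ _
  have hε₁M : ε₁ ≤ S.limitValue / 2 := min_le_right _ _
  obtain ⟨B, hB⟩ := S.exists_steering_radius (half_pos hδ) (by linarith) hε₁0
  obtain ⟨t, N₁, hN₁, hball⟩ := (eventually_exists_ball hS hε₁0 B).exists
  have hN₁0 := (S.nonneg_and_sum_of_value_ne_zero t N₁ (by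
    have := hball N₁ hN₁ (by simp)
    linarith)).1
  -- Replacing `n * x` by `N`, and then subtracting `N₁`, costs at most this numerator on any `F`;
  -- for `L ≥ L₀` half of the margin pays for it.
  obtain ⟨L₀, hL₀⟩ := exists_nat_ge ((Fintype.card E * |C| + t) / (δ / 2))
  filter_upwards [S.eventually_value_le hε, eventually_ge_atTop (t + (L₀ + 1))] with n hn hnL N
    hN hnear
  rw [abs_le]
  refine ⟨?_, by linarith [hn N]⟩
  obtain ⟨L, rfl⟩ : ∃ L, n = t + L := ⟨n - t, by omega⟩
  have hL0 : 0 < L := by omega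
  have hL0' : (0 : ℝ) < L := by exact_mod_cast hL0
  have hLbig : Fintype.card E * |C| + t ≤ L * (δ / 2) := by
    rw [← div_le_iff₀ (by positivity)]
    refine hL₀.trans ?_
    have : L₀ ≤ L := by omega
    exact_mod_cast this
  have h1 := hB t L N N₁ (S.limitValue - ε₁) hL0 (by linarith) (by rw [hN]; push_cast; ring) hN₁
    ?_ hball
  · nlinarith
  · intro F hF hF'
    have h2 := hx F hF hF'
    have hd : 0 ≤ ((S.full F).card : ℝ) / Fintype.card V := by positivity
    rw [← Finset.sum_div, le_div_iff₀ hL0', Finset.sum_sub_distrib]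
    have h3 : ((t + L : ℕ) : ℝ) * ∑ e ∈ F, x e - Fintype.card E * |C| ≤ ∑ e ∈ F, (N e : ℝ) := by
      have hC : (F.card : ℝ) * |C| ≤ Fintype.card E * |C| := by
        gcongr
        exact Finset.card_le_univ F
      calc _ ≤ ((t + L : ℕ) : ℝ) * ∑ e ∈ F, x e - F.card * |C| := by linarith
        _ = ∑ e ∈ F, (((t + L : ℕ) : ℝ) * x e - |C|) := by
            rw [Finset.sum_sub_distrib, ← Finset.mul_sum]; simp
        _ ≤ _ := Finset.sum_le_sum fun e _ => by
            have := (abs_le.1 (hnear e)).1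
            linarith [le_abs_self C]
    have h4 : ∑ e ∈ F, (N₁ e : ℝ) ≤ t := by
      have : ∑ e ∈ F, N₁ e ≤ t := by
        rw [← hN₁]
        exact Finset.sum_le_sum_of_subset_of_nonneg (Finset.subset_univ _) fun e _ _ => hN₁0 e
      exact_mod_cast this
    have h5 : (L : ℝ) * (((S.full F).card : ℝ) / Fintype.card V + δ) ≤
        ((t + L : ℕ) : ℝ) * ∑ e ∈ F, x e := by
      have h6 : (L : ℝ) ≤ ((t + L : ℕ) : ℝ) := by exact_mod_cast Nat.le_add_left L t
      have : 0 ≤ ((S.full F).card : ℝ) / Fintype.card V + δ := by linarith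
      gcongr
    linarith

end ChoiceSystem

/-! ### Strategies on a graph and Bellman values -/

section Game

variable {V : Type*} [Fintype V] [DecidableEq V] (G : SimpleGraph V) [DecidableRel G.Adj]

/-- The game on a graph without isolated vertices: draws of a vertex, choices of an incident
edge. -/
def graphSystem (h : ∀ v, ∃ e : G.edgeSet, v ∈ (e : Sym2 V)) : ChoiceSystem V G.edgeSet where
  inc v := Finset.univ.filter fun e : G.edgeSet => v ∈ (e : Sym2 V)
  nonempty v := by
    obtain ⟨e, he⟩ := h v
    exact ⟨e, by simpa using he⟩

variable {G} (h : ∀ v, ∃ e : G.edgeSet, v ∈ (e : Sym2 V))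

theorem mem_graphSystem_inc {v : V} {e : G.edgeSet} :
    e ∈ (graphSystem G h).inc v ↔ v ∈ (e : Sym2 V) := by simp [graphSystem]

theorem card_graphSystem_inc (v : V) : ((graphSystem G h).inc v).card = G.degree v := by
  rw [← G.card_incidenceFinset_eq_degree, ← Finset.card_map (Function.Embedding.subtype _)]
  congr 1
  ext e
  simp only [Finset.mem_map, mem_graphSystem_inc, SimpleGraph.mem_incidenceFinset]
  constructor
  · rintro ⟨f, hf, rfl⟩
    exact ⟨f.2, hf⟩
  · intro he
    exact ⟨⟨e, he.1⟩, he.2, rfl⟩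

/-- The edges of `F` at `v` are a subset of `inc v`, so equality of degrees is equality of sets. -/
theorem card_full_graphSystem (F : Finset G.edgeSet) :
    ((graphSystem G h).full F).card = fullDegCount G F := by
  rw [fullDegCount]
  congr 1
  ext v
  rw [ChoiceSystem.mem_full, Finset.mem_filter, degIn]
  simp only [Finset.mem_univ, true_and]
  have h1 : (F.filter fun e : G.edgeSet => v ∈ (e : Sym2 V)) ⊆ (graphSystem G h).inc v :=
    fun e he => by
      rw [mem_graphSystem_inc]
      exact (Finset.mem_filter.1 he).2
  rw [← card_graphSystem_inc h v]
  constructor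
  · intro h2
    congr 1
    refine Finset.Subset.antisymm h1 fun e he => Finset.mem_filter.2 ⟨h2 he, ?_⟩
    rwa [mem_graphSystem_inc] at he
  · intro h2
    rw [← Finset.eq_of_subset_of_card_le h1 h2.ge]
    exact Finset.filter_subset _ _

/-- A win has probability at most the value, whatever happened before. -/
theorem card_win_le_value [Nonempty V] (σ : Strategy G) (N₀ : G.edgeSet → ℕ) (t : ℕ)
    (hist : List V) :
    ((Finset.univ.filter fun ω : Fin t → V =>
      σ.state N₀ ((List.ofFn ω).reverse ++ hist) = 0).card : ℝ) / (Fintype.card V : ℝ) ^ t ≤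
      (graphSystem G h).value t (σ.state N₀ hist) := by
  have hk : (0 : ℝ) < Fintype.card V := by exact_mod_cast Fintype.card_pos
  induction t generalizing hist with
  | zero =>
    rw [ChoiceSystem.value]
    split_ifs with h0 <;> simp [h0]
  | succ t ih =>
    refine le_trans ?_ ((graphSystem G h).average_le_value_succ t _ (fun v => σ.choose hist v)
      fun v => (mem_graphSystem_inc h).2 (σ.incident hist v))
    -- Split off the first of the remaining draws; the reversal places it directly in front of
    -- `hist`.
    have h1 : ((Finset.univ.filter fun ω : Fin (t + 1) → V =>
        σ.state N₀ ((List.ofFn ω).reverse ++ hist) = 0).card : ℝ) =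
        ∑ v, ((Finset.univ.filter fun ω : Fin t → V =>
          σ.state N₀ ((List.ofFn ω).reverse ++ (v :: hist)) = 0).card : ℝ) := by
      simp only [Finset.card_filter, Nat.cast_sum]
      rw [← (Fin.consEquiv fun _ => V).sum_comp, Fintype.sum_prod_type]
      simp [Fin.consEquiv, List.ofFn_succ]
    rw [h1, pow_succ, ← div_div, Finset.sum_div]
    gcongr with v
    exact ih (v :: hist)

variable (G) in
/-- The states under optimal play, after the draws of a list (most recent first). -/
noncomputable def optState (N₀ : G.edgeSet → ℕ) : List V → G.edgeSet → ℤ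
  | [] => fun e => (N₀ e : ℤ)
  -- The rounds remaining after this draw; the subtraction truncates only for histories longer than
  -- the game.
  | v :: l => optState N₀ l -
      Pi.single ((graphSystem G h).best (total N₀ - (l.length + 1)) (optState N₀ l) v) 1

/-- A strategy that maximizes the value in every round. -/
noncomputable def optStrategy (N₀ : G.edgeSet → ℕ) : Strategy G where
  choose l v := (graphSystem G h).best (total N₀ - (l.length + 1)) (optState G h N₀ l) v
  incident _ _ := (mem_graphSystem_inc h).1 (ChoiceSystem.best_mem _ _ _ _)

theorem optStrategy_state (N₀ : G.edgeSet → ℕ) (l : List V) :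
    (optStrategy h N₀).state N₀ l = optState G h N₀ l := by
  induction l with
  | nil => rfl
  | cons v l ih => rw [Strategy.state, ih, optState, optStrategy]

theorem card_win_optStrategy [Nonempty V] (N₀ : G.edgeSet → ℕ) (t : ℕ) (hist : List V)
    (ht : t + hist.length = total N₀) :
    ((Finset.univ.filter fun ω : Fin t → V =>
      (optStrategy h N₀).state N₀ ((List.ofFn ω).reverse ++ hist) = 0).card : ℝ) /
        (Fintype.card V : ℝ) ^ t =
      (graphSystem G h).value t ((optStrategy h N₀).state N₀ hist) := by
  induction t generalizing hist with
  | zero =>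
    rw [ChoiceSystem.value]
    split_ifs with h0 <;> simp [h0]
  | succ t ih =>
    have h1 : ((Finset.univ.filter fun ω : Fin (t + 1) → V =>
        (optStrategy h N₀).state N₀ ((List.ofFn ω).reverse ++ hist) = 0).card : ℝ) =
        ∑ v, ((Finset.univ.filter fun ω : Fin t → V =>
          (optStrategy h N₀).state N₀ ((List.ofFn ω).reverse ++ (v :: hist)) = 0).card : ℝ) := by
      simp only [Finset.card_filter, Nat.cast_sum]
      rw [← (Fin.consEquiv fun _ => V).sum_comp, Fintype.sum_prod_type]
      simp [Fin.consEquiv, List.ofFn_succ]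
    rw [h1, pow_succ, ← div_div, Finset.sum_div, ChoiceSystem.value_succ]
    congr 1
    refine Finset.sum_congr rfl fun v _ => ?_
    rw [ih (v :: hist) (by rw [List.length_cons]; omega)]
    have h2 : total N₀ - (hist.length + 1) = t := by omega
    rw [Strategy.state]
    congr 3
    rw [optStrategy_state]
    simp only [optStrategy, h2]

/-- No strategy beats the value, and `optStrategy` attains it, so the supremum is a maximum. -/
theorem optWinProb_eq_value [Nonempty V] (N₀ : G.edgeSet → ℕ) :
    optWinProb G N₀ = (graphSystem G h).value (total N₀) (fun e => (N₀ e : ℤ)) := by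
  have hle : ∀ σ : Strategy G, σ.winProb N₀ ≤
      (graphSystem G h).value (total N₀) (fun e => (N₀ e : ℤ)) := fun σ => by
    simpa [Strategy.winProb, Strategy.state] using card_win_le_value h σ N₀ (total N₀) []
  have hopt : (optStrategy h N₀).winProb N₀ =
      (graphSystem G h).value (total N₀) (fun e => (N₀ e : ℤ)) := by
    simpa [Strategy.winProb, Strategy.state] using
      card_win_optStrategy h N₀ (total N₀) [] (by simp)
  have : Nonempty (Strategy G) := ⟨optStrategy h N₀⟩
  refine le_antisymm (ciSup_le hle) ?_
  rw [← hopt]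
  exact le_ciSup (f := fun σ : Strategy G => σ.winProb N₀) ⟨_, by rintro _ ⟨σ, rfl⟩; exact hle σ⟩ _

/-- A set `F` violating the condition contains all edges at each vertex it touches. Along a walk
this spreads to every vertex, and `F` would contain all edges. -/
theorem linked_graphSystem (hconn : G.Connected) : (graphSystem G h).Linked := by
  intro F hF hF'
  by_contra! hcon
  have hcon' : ∀ v, (∃ e ∈ F, v ∈ (e : Sym2 V)) → ∀ e : G.edgeSet, v ∈ (e : Sym2 V) → e ∈ F := by
    rintro v ⟨e, he, hv⟩ f hf
    exact hcon v ⟨e, he, (mem_graphSystem_inc h).2 hv⟩ ((mem_graphSystem_inc h).2 hf)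
  obtain ⟨e₀, he₀⟩ := hF
  obtain ⟨⟨a, b⟩, hab⟩ := e₀
  have hall : ∀ v, ∃ e ∈ F, v ∈ (e : Sym2 V) := by
    intro v
    obtain ⟨p⟩ := hconn.preconnected a v
    have hstart : ∃ e ∈ F, a ∈ (e : Sym2 V) := ⟨_, he₀, Sym2.mem_mk_left a b⟩
    clear he₀ hab
    induction p with
    | nil => exact hstart
    | cons hadj p ih =>
      have hmem := G.mem_edgeSet.2 hadj
      refine ih ⟨⟨_, hmem⟩, hcon' _ hstart ⟨_, hmem⟩ ?_, ?_⟩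
      · exact Sym2.mem_mk_left _ _
      · exact Sym2.mem_mk_right _ _
  refine hF' (Finset.eq_univ_iff_forall.2 fun e => ?_)
  obtain ⟨⟨a, b⟩, hab⟩ := e
  exact hcon' a (hall a) _ (Sym2.mem_mk_left a b)

end Game

/-! ### The regions of the simplex -/

section Regions

variable {V : Type*} [Fintype V] [DecidableEq V] {G : SimpleGraph V} [DecidableRel G.Adj]

theorem exists_mem_edge_of_connected (hconn : G.Connected) (e : G.edgeSet) (v : V) :
    ∃ e : G.edgeSet, v ∈ (e : Sym2 V) := by
  obtain ⟨⟨a, b⟩, hab⟩ := e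
  obtain ⟨p⟩ := hconn.preconnected v a
  cases p with
  | nil => exact ⟨⟨_, hab⟩, Sym2.mem_mk_left _ _⟩
  | cons hadj p => exact ⟨⟨_, G.mem_edgeSet.2 hadj⟩, Sym2.mem_mk_left _ _⟩

/-- The constants involve only `ε`, `C` and the graph, not `x`, so both claims about the
inaccessible region follow. -/
theorem optWinProb_le_exp [Nonempty V] (h : ∀ v, ∃ e : G.edgeSet, v ∈ (e : Sym2 V))
    {x : EuclideanSpace ℝ G.edgeSet} {F : Finset G.edgeSet} {ε : ℝ} (hε : 0 < ε) (hε1 : ε ≤ 1)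
    (hF : ∑ e ∈ F, x e ≤ (fullDegCount G F : ℝ) / Fintype.card V - ε) {C : ℝ}
    {N₀ : G.edgeSet → ℕ} (hN : Near G C x N₀) :
    optWinProb G N₀ ≤ Real.exp (ε / 2 * (Fintype.card G.edgeSet * |C|)) *
      Real.exp (-(ε ^ 2 / 4) * (total N₀ : ℝ)) := by
  rw [optWinProb_eq_value h]
  refine (graphSystem G h).value_le_exp F hε hε1 _ _ ?_
  rw [card_full_graphSystem]
  push_cast
  have hC : (F.card : ℝ) * |C| ≤ Fintype.card G.edgeSet * |C| := by
    gcongr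
    exact Finset.card_le_univ F
  calc ∑ e ∈ F, (N₀ e : ℝ) ≤ ∑ e ∈ F, ((total N₀ : ℝ) * x e + |C|) :=
        Finset.sum_le_sum fun e _ => by
          have := (abs_le.1 (hN e)).2
          linarith [le_abs_self C]
    _ = total N₀ * ∑ e ∈ F, x e + F.card * |C| := by
        rw [Finset.sum_add_distrib, ← Finset.mul_sum]; simp
    _ ≤ _ := by gcongr

/-- Points of the simplex at a positive distance from the reachable region violate one of its
inequalities by a positive constant. -/
theorem exists_violation_of_infDist [Nonempty V]
    (h : ∀ v, ∃ e : G.edgeSet, v ∈ (e : Sym2 V)) (hS : (graphSystem G h).Linked)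
    [Nonempty G.edgeSet] {δ : ℝ} (hδ : 0 < δ) :
    ∃ ε : ℝ, 0 < ε ∧ ε ≤ 1 ∧ ∀ x : EuclideanSpace ℝ G.edgeSet, (∀ e, 0 ≤ x e) →
      ∑ e, x e = 1 → δ ≤ Metric.infDist x (reachable G) →
      ∃ F : Finset G.edgeSet, ∑ e ∈ F, x e ≤ (fullDegCount G F : ℝ) / Fintype.card V - ε := by
  obtain ⟨κ, y, hκ, hκ1, hy0, hy1, hy⟩ := hS.exists_hasMargin
  set m : ℝ := (Fintype.card G.edgeSet : ℝ) with hm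
  have hm1 : 1 ≤ m := by rw [hm]; exact_mod_cast Fintype.card_pos
  set s : ℝ := min 1 (δ / (2 * m)) with hs
  have hs0 : 0 < s := lt_min one_pos (by positivity)
  have hs1 : s ≤ 1 := min_le_left _ _
  have hsm : s * m < δ := by
    calc s * m ≤ δ / (2 * m) * m := by gcongr; exact min_le_right _ _
      _ = δ / 2 := by field_simp
      _ < δ := by linarith
  refine ⟨s * κ, by positivity, mul_le_one₀ hs1 hκ.le hκ1, fun x hx0 hx1 hdist => ?_⟩
  by_contra! hcon
  -- If every inequality failed by less than `s * κ`, mixing in a share `s` of the point `y` with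
  -- margin `κ` would leave a slack `s * (s * κ)`: a reachable point within distance `s * m < δ` of
  -- `x`.
  set z : EuclideanSpace ℝ G.edgeSet := WithLp.toLp 2 (fun e => (1 - s) * x e + s * y e) with hz
  have hze : ∀ e, z e = (1 - s) * x e + s * y e := fun e => rfl
  have hzmem : z ∈ reachable G := by
    refine ⟨⟨fun e => ?_, ?_⟩, fun F hF hF' => ?_⟩
    · rw [hze]
      have := mul_nonneg (sub_nonneg.2 hs1) (hx0 e)
      have := mul_nonneg hs0.le (hy0 e)
      linarith
    · simp only [hze]
      rw [Finset.sum_add_distrib, ← Finset.mul_sum, ← Finset.mul_sum, hx1, hy1]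
      ring
    · simp only [hze]
      rw [Finset.sum_add_distrib, ← Finset.mul_sum, ← Finset.mul_sum]
      have h1 := (hcon F).le
      have h2 := hy F hF hF'
      rw [card_full_graphSystem] at h2
      have h3 := mul_le_mul_of_nonneg_left h1 (sub_nonneg.2 hs1)
      have h4 := mul_le_mul_of_nonneg_left h2 hs0.le
      have h5 : 0 < s * (s * κ) := by positivity
      linarith
  have hd : dist x z ≤ s * m := by
    rw [EuclideanSpace.dist_eq, Real.sqrt_le_left (by positivity)]
    calc ∑ e, dist (x e) (z e) ^ 2 ≤ ∑ _e : G.edgeSet, s ^ 2 := by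
          refine Finset.sum_le_sum fun e _ => ?_
          have hxe : x e ≤ 1 := by
            rw [← hx1]; exact Finset.single_le_sum (fun e _ => hx0 e) (Finset.mem_univ e)
          have hye : y e ≤ 1 := by
            rw [← hy1]; exact Finset.single_le_sum (fun e _ => hy0 e) (Finset.mem_univ e)
          have h1 : x e - z e = s * (x e - y e) := by rw [hze]; ring
          have h2 : |x e - y e| ≤ 1 := by
            rw [abs_le]
            constructor <;> linarith [hx0 e, hy0 e]
          rw [Real.dist_eq, h1, abs_mul, abs_of_pos hs0]
          gcongr
          exact mul_le_of_le_one_right hs0.le h2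
      _ = m * s ^ 2 := by simp [hm]
      _ ≤ m * (m * s ^ 2) := le_mul_of_one_le_left (by positivity) hm1
      _ = (s * m) ^ 2 := by ring
  have := Metric.infDist_le_dist_of_mem (x := x) hzmem
  linarith

theorem exists_hasMargin_of_mem_reachable [Nonempty V]
    (h : ∀ v, ∃ e : G.edgeSet, v ∈ (e : Sym2 V)) {x : EuclideanSpace ℝ G.edgeSet}
    (hx : x ∈ reachable G) : ∃ δ : ℝ, 0 < δ ∧ (graphSystem G h).HasMargin δ (fun e => x e) := by
  have hev : ∀ᶠ δ : ℝ in 𝓝[>] 0, ∀ F : Finset G.edgeSet, F.Nonempty → F ≠ Finset.univ →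
      (((graphSystem G h).full F).card : ℝ) / Fintype.card V + δ ≤ ∑ e ∈ F, x e := by
    rw [eventually_all]
    intro F
    by_cases hF : F.Nonempty ∧ F ≠ Finset.univ
    · have := hx.2 F hF.1 hF.2
      filter_upwards [Ioc_mem_nhdsGT (sub_pos.2 this)] with δ hδ _ _
      rw [card_full_graphSystem]
      linarith [hδ.2]
    · exact Eventually.of_forall fun δ h1 h2 => absurd ⟨h1, h2⟩ hF
  obtain ⟨δ, hδ, hδ0⟩ := (hev.and self_mem_nhdsWithin).exists
  exact ⟨δ, hδ0, hδ⟩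

end Regions

end SeqAssign

theorem theorem1 {V : Type*} [Fintype V] [DecidableEq V] (G : SimpleGraph V) [DecidableRel G.Adj]
    (hconn : G.Connected) (hedges : 2 ≤ G.edgeFinset.card) :
    -- (i) exponential decay at every point of the inaccessible region ...
    (∀ x ∈ SeqAssign.inaccessible G, ∃ r : ℝ, 0 < r ∧ ∀ C : ℝ, ∃ A : ℝ,
      ∀ N₀ : G.edgeSet → ℕ, SeqAssign.Near G C x N₀ →
        SeqAssign.optWinProb G N₀ ≤ A * Real.exp (-r * (SeqAssign.total N₀ : ℝ))) ∧
    -- ... with a rate bounded away from zero at positive distance from the reachable region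
    (∀ δ : ℝ, 0 < δ → ∃ r : ℝ, 0 < r ∧ ∀ C : ℝ, ∃ A : ℝ,
      ∀ x ∈ SeqAssign.inaccessible G, δ ≤ Metric.infDist x (SeqAssign.reachable G) →
        ∀ N₀ : G.edgeSet → ℕ, SeqAssign.Near G C x N₀ →
          SeqAssign.optWinProb G N₀ ≤ A * Real.exp (-r * (SeqAssign.total N₀ : ℝ))) ∧
    -- (ii) a positive limit, the same throughout the reachable region
    (∃ c : ℝ, 0 < c ∧ ∀ x ∈ SeqAssign.reachable G, ∀ C : ℝ, ∀ ε : ℝ, 0 < ε → ∃ n₀ : ℕ,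
      ∀ N₀ : G.edgeSet → ℕ, n₀ ≤ SeqAssign.total N₀ → SeqAssign.Near G C x N₀ →
        |SeqAssign.optWinProb G N₀ - c| < ε) := by
  have hV : Nonempty V := hconn.nonempty
  have hE : Nontrivial G.edgeSet := by
    rw [← Fintype.one_lt_card_iff_nontrivial, ← SimpleGraph.edgeFinset_card]
    omega
  obtain ⟨e₀⟩ : Nonempty G.edgeSet := inferInstance
  have h := SeqAssign.exists_mem_edge_of_connected hconn e₀
  have hS := SeqAssign.linked_graphSystem h hconn
  refine ⟨fun x hx => ?_, fun δ hδ => ?_, ?_⟩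
  · obtain ⟨F, -, -, hF⟩ := hx.2
    set ε : ℝ := min 1 ((SeqAssign.fullDegCount G F : ℝ) / Fintype.card V - ∑ e ∈ F, x e) with hε
    have hε0 : 0 < ε := lt_min one_pos (sub_pos.2 hF)
    exact ⟨ε ^ 2 / 4, by positivity, fun C => ⟨_, fun N₀ hN =>
      SeqAssign.optWinProb_le_exp h hε0 (min_le_left _ _)
        (le_sub_comm.1 (min_le_right _ _)) hN⟩⟩
  · obtain ⟨ε, hε0, hε1, hε⟩ := SeqAssign.exists_violation_of_infDist h hS hδ
    refine ⟨ε ^ 2 / 4, by positivity, fun C =>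
      ⟨Real.exp (ε / 2 * (Fintype.card G.edgeSet * |C|)), fun x hx hdist N₀ hN => ?_⟩⟩
    obtain ⟨F, hF⟩ := hε x hx.1.1 hx.1.2 hdist
    exact SeqAssign.optWinProb_le_exp h hε0 hε1 hF hN
  · refine ⟨(SeqAssign.graphSystem G h).limitValue, SeqAssign.ChoiceSystem.limitValue_pos _ hS,
      fun x hx C ε hε => ?_⟩
    obtain ⟨δ, hδ, hmar⟩ := SeqAssign.exists_hasMargin_of_mem_reachable h hx
    obtain ⟨n₀, hn₀⟩ := Filter.eventually_atTop.1
      (hmar.eventually_value_near hS hδ C (half_pos hε))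
    refine ⟨n₀, fun N₀ hn hN => ?_⟩
    rw [SeqAssign.optWinProb_eq_value h]
    refine (hn₀ _ hn _ ?_ ?_).trans_lt (by linarith)
    · simp [SeqAssign.total]
    · intro e
      exact_mod_cast hN e
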